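/- Let $k$ be a field, $\ell$ a prime number different from $\operatorname{char}(k)$, $k_s$ a separable closure of $k$, and let $\operatorname{Im}\chi\subset\mathbf Z_\ell^*$ be the image of the $\ell^\infty$-cyclotomic character $\chi:\operatorname{Gal}(k_s/k)\to\mathbf Z_\ell^*$. The invariants $t$ and $m$ of $(k,\ell)$ are defined as follows (with $\ell^\infty=0$). If $\ell\neq 2$, then $\operatorname{Im}\chi=C_t\times(1+\ell^m\mathbf Z_\ell)$, where $t$ divides $\ell-1$, $C_t$ is cyclic of order $t$ and $m\in\{1,2,\dots,\infty\}$. If $\ell=2$, then for some $m\in\{2,3,\dots,\infty\}$ either (a) $\operatorname{Im}\chi=1+2^m\mathbf Z_2$, and $t=1$; or (b) $\operatorname{Im}\chi$ is the closed subgroup generated by $-1+2^m$, and $t=2$; or (c) $\operatorname{Im}\chi=\{\pm1\}\times(1+2^m\mathbf Z_2)$, and $t=2$. Write $v_\ell(A)$ for the $\ell$-adic valuation of the order of a finite group $A$, $\varphi$ for Euler's function, $[x]$ for the integral part of $x$, and $\Phi_t$ for the $t$-th cyclotomic polynomial. Assume $m<\infty$. (i) For every $n\ge 1$ there exist a $k$-torus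 $T$ of dimension $n$ and a finite subgroup $A$ of $T(k)$ such that $v_\ell(A)=m\cdot[n/\varphi(t)]$. (ii) More precisely, let $K=k(z_\ell)$ if $\ell\ne2$ and $K=k(i)$ if $\ell=2$, where $z_\ell\in k_s$ is a primitive $\ell$-th root of unity and $i\in k_s$ is a primitive $4$-th root of unity. Then $\operatorname{Gal}(K/k)$ is cyclic. Let $\sigma$ be a generator of it, let $\Psi=(X^t-1)/\Phi_t$, and let $T_0$ be the image of the endomorphism $\Psi(\sigma)$ of the torus $R_{K/k}\mathbf G_m$ (Weil restriction). Then $T_0$ is a $k$-torus of dimension $\varphi(t)$, the group $T_0(k)$ contains an element of order $\ell^m$, and for every $n\ge1$ the torus $T$ in (i) can be taken isomorphic to $T_0^{a}\times\mathbf G_m^{b}$, where $a=[n/\varphi(t)]$ and $b=n-a\varphi(t)$. -/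

import Mathlib

open scoped TensorProduct

universe u

noncomputable section

namespace SerreTorus

/-! ### The cyclotomic invariants `t` and `m` of a field -/

/-- The image in `ℤ_ℓˣ` of the `ℓ^∞`-cyclotomic character of the absolute Galois group
`Gal(k_s/k)`, where `k_s` is the separable closure of `k`. -/
def cyclotomicImage (k : Type u) [Field k] (ℓ : ℕ) [Fact ℓ.Prime] : Subgroup ℤ_[ℓ]ˣ :=
  ((cyclotomicCharacter (SeparableClosure k) ℓ).comp
    (MulSemiringAction.toRingAut Gal(SeparableClosure k/k) (SeparableClosure k))).range

/-- `ℓ ^ d` in `ℤ_ℓ` for `d = 0, 1, …, ∞`, with the convention `ℓ ^ ∞ = 0`. -/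
def ellPow (ℓ : ℕ) [Fact ℓ.Prime] : ℕ∞ → ℤ_[ℓ]
  | ⊤ => 0
  | (d : ℕ) => (ℓ : ℤ_[ℓ]) ^ d

/-- The subgroup `{u ∈ ℤ_ℓˣ | u ≡ 1 mod ℓ ^ d}`; it is `1 + ℓ ^ d ℤ_ℓ` for `d = 1, 2, …, ∞`. -/
def oneUnits (ℓ : ℕ) [Fact ℓ.Prime] (d : ℕ∞) : Subgroup ℤ_[ℓ]ˣ where
  carrier := {u | ellPow ℓ d ∣ (u : ℤ_[ℓ]) - 1}
  one_mem' := by simp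
  mul_mem' {a b} ha hb := by
    have h : ((a * b : ℤ_[ℓ]ˣ) : ℤ_[ℓ]) - 1 = (a : ℤ_[ℓ]) * (b - 1) + (a - 1) := by
      push_cast; ring
    show ellPow ℓ d ∣ _
    rw [h]
    exact dvd_add (Dvd.dvd.mul_left hb _) ha
  inv_mem' {a} ha := by
    have h : ((a⁻¹ : ℤ_[ℓ]ˣ) : ℤ_[ℓ]) - 1 = -((a⁻¹ : ℤ_[ℓ]ˣ) : ℤ_[ℓ]) * (a - 1) := by
      rw [mul_sub, neg_mul, Units.inv_mul]; ring
    show ellPow ℓ d ∣ _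
    rw [h]
    exact Dvd.dvd.mul_left ha _

/-- `t` and `m` are the cyclotomic invariants of `k` at the prime `ℓ` (different from the
characteristic of `k`).

If `ℓ ≠ 2`: the image of the cyclotomic character is `C_t × (1 + ℓ ^ m ℤ_ℓ)` with `t ∣ ℓ - 1`,
`C_t` cyclic of order `t`, and `m = 1, 2, …, ∞`.

If `ℓ = 2`: `m = 2, 3, …, ∞`, and one of the following holds:
(a) the image is `1 + 2 ^ m ℤ_2`, and `t = 1`;
(b) the image is the closed subgroup generated by `-1 + 2 ^ m`, and `t = 2`;
(c) the image is `{1, -1} × (1 + 2 ^ m ℤ_2)`, and `t = 2`. -/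
def IsCyclotomicInvariants (k : Type u) [Field k] (ℓ : ℕ) [Fact ℓ.Prime] (t : ℕ) (m : ℕ∞) :
    Prop :=
  (ℓ ≠ 2 ∧ 1 ≤ m ∧ t ∣ ℓ - 1 ∧
    ∃ C : Subgroup ℤ_[ℓ]ˣ, IsCyclic C ∧ Nat.card C = t ∧
      cyclotomicImage k ℓ = C ⊔ oneUnits ℓ m) ∨
  (ℓ = 2 ∧ 2 ≤ m ∧
    ((t = 1 ∧ cyclotomicImage k ℓ = oneUnits ℓ m) ∨
     (t = 2 ∧ ∃ g : ℤ_[ℓ]ˣ, (g : ℤ_[ℓ]) = -1 + ellPow ℓ m ∧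
        cyclotomicImage k ℓ = (Subgroup.zpowers g).topologicalClosure) ∨
     (t = 2 ∧ cyclotomicImage k ℓ = Subgroup.zpowers (-1) ⊔ oneUnits ℓ m)))

/-! ### Affine group schemes and tori

An affine group scheme `G` over `k` is given by its coordinate ring, a commutative `k`-Hopf
algebra `H`; one has `G(R) = Hom_{k-alg}(H, R)`, with the convolution product as group law. -/

/-- The set `G(R)` of `R`-points of the affine group scheme with coordinate ring `H`; its
multiplication is the convolution product. -/
abbrev Points (k : Type u) [Field k] (H : CommHopfAlgCat.{u} k) (R : Type u) [CommRing R]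
    [Algebra k R] : Type u :=
  WithConv (H →ₐ[k] R)

/-- The map `G(R) → G(S)` induced by a homomorphism of `k`-algebras `R → S`. -/
def Points.map {k : Type u} [Field k] {H : CommHopfAlgCat.{u} k} {R S : Type u} [CommRing R]
    [Algebra k R] [CommRing S] [Algebra k S] (f : R →ₐ[k] S) (x : Points k H R) :
    Points k H S :=
  WithConv.toConv (f.comp x.ofConv)

/-- The map `G(R) → G'(R)` induced by the homomorphism of group schemes `G → G'` with
comorphism `f : H' → H`. -/
def Points.push {k : Type u} [Field k] {H H' : CommHopfAlgCat.{u} k} {R : Type u} [CommRing R]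
    [Algebra k R] (f : H' →ₐc[k] H) (x : Points k H R) : Points k H' R :=
  WithConv.toConv (x.ofConv.comp (f : H' →ₐ[k] H))

/-- After base change to the extension `L` of `k`, the affine group scheme with coordinate ring `H`
becomes isomorphic to `𝔾_m ^ n`, whose coordinate ring is the group algebra `L[ℤ ^ n]`. -/
def IsSplitTorusOver (k : Type u) [Field k] (L : Type u) [Field L] [Algebra k L] (n : ℕ)
    (H : CommHopfAlgCat.{u} k) : Prop :=
  Nonempty ((L ⊗[k] H) ≃ₐc[L] AddMonoidAlgebra L (Fin n → ℤ))

/-- The affine group scheme with coordinate ring `H` is a `k`-torus of dimension `n`: it becomes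
isomorphic to `𝔾_m ^ n` over the separable closure of `k`. -/
def IsTorus (k : Type u) [Field k] (n : ℕ) (H : CommHopfAlgCat.{u} k) : Prop :=
  IsSplitTorusOver k (SeparableClosure k) n H

/-! ### The torus `R_{K/k} 𝔾_m`, and the image of one of its endomorphisms -/

/-- The field `K = k(z_ℓ)` if `ℓ ≠ 2` and `K = k(i)` if `ℓ = 2` (with `i = z_4`), as a subfield of
the separable closure of `k`. -/
def cyclotomicField (k : Type u) [Field k] (ℓ : ℕ) :
    IntermediateField k (SeparableClosure k) :=
  IntermediateField.adjoin k
    {z : SeparableClosure k | IsPrimitiveRoot z (if ℓ = 2 then 4 else ℓ)}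

/-- The action of `P(σ)` on `(R_{K/k} 𝔾_m)(R) = (K ⊗ R)ˣ`, where `σ` is a `k`-automorphism of `K`
and `P` is a polynomial with integer coefficients: if `P = ∑ a_j X ^ j`, then `u` is sent to
`∏ (σ ^ j u) ^ a_j`. -/
def polyAct (k : Type u) [Field k] {K : Type u} [Field K] [Algebra k K] (σ : K ≃ₐ[k] K)
    (P : Polynomial ℤ) (R : Type u) [CommRing R] [Algebra k R] :
    (K ⊗[k] R)ˣ →* (K ⊗[k] R)ˣ :=
  MonoidHom.toAdditive.symm
    (Polynomial.aeval
      (AddMonoidHom.toIntLinearMap (MonoidHom.toAdditive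
        (Units.map (Algebra.TensorProduct.map (σ : K →ₐ[k] K) (AlgHom.id k R) :
          K ⊗[k] R →* K ⊗[k] R))) : Module.End ℤ (Additive (K ⊗[k] R)ˣ)) P).toAddMonoidHom

/-- `e` identifies the affine group scheme with coordinate ring `B` with the Weil restriction
`R_{K/k} 𝔾_m`, i.e. with the group functor `R ↦ (K ⊗ R)ˣ` on commutative `k`-algebras. -/
def IsWeilRestrictionGm (k : Type u) [Field k] (K : Type u) [Field K] [Algebra k K]
    (B : CommHopfAlgCat.{u} k)
    (e : ∀ (R : Type u) [CommRing R] [Algebra k R], Points k B R ≃* (K ⊗[k] R)ˣ) : Prop :=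
  ∀ (R S : Type u) [CommRing R] [Algebra k R] [CommRing S] [Algebra k S] (f : R →ₐ[k] S)
    (x : Points k B R),
    e S (x.map f) =
      Units.map (Algebra.TensorProduct.map (AlgHom.id k K) f : K ⊗[k] R →* K ⊗[k] S) (e R x)

/-- The affine group scheme with coordinate ring `H` is the image of the endomorphism `P(σ)` of
`R_{K/k} 𝔾_m`: this endomorphism factors as `R_{K/k} 𝔾_m → T → R_{K/k} 𝔾_m`, where the first
homomorphism is a quotient map (its comorphism is injective) and the second one is a closed
immersion (its comorphism is surjective). -/
def IsImagePolyAct (k : Type u) [Field k] {K : Type u} [Field K] [Algebra k K] (σ : K ≃ₐ[k] K)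
    (P : Polynomial ℤ) (H : CommHopfAlgCat.{u} k) : Prop :=
  ∃ (B : CommHopfAlgCat.{u} k)
    (e : ∀ (R : Type u) [CommRing R] [Algebra k R], Points k B R ≃* (K ⊗[k] R)ˣ)
    (q : H →ₐc[k] B) (j : B →ₐc[k] H),
    IsWeilRestrictionGm k K B e ∧ Function.Injective q ∧ Function.Surjective j ∧
      ∀ (R : Type u) [CommRing R] [Algebra k R] (x : Points k B R),
        e R ((x.push q).push j) = polyAct k σ P R (e R x)

/-- The polynomial `Ψ = (X ^ t - 1) / Φ_t` (an exact division). -/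
def psi (t : ℕ) : Polynomial ℤ :=
  (Polynomial.X ^ t - 1) /ₘ Polynomial.cyclotomic t ℤ

/-- The affine group scheme with coordinate ring `H` is isomorphic to `T₀ ^ a × 𝔾_m ^ b`, where
`T₀` is the affine group scheme with coordinate ring `H₀`: there is an isomorphism of group
functors `H(R) ≃ T₀(R) ^ a × (Rˣ) ^ b`. -/
def IsProduct (k : Type u) [Field k] (H₀ : CommHopfAlgCat.{u} k) (a b : ℕ)
    (H : CommHopfAlgCat.{u} k) : Prop :=
  ∃ e : ∀ (R : Type u) [CommRing R] [Algebra k R],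
      Points k H R ≃* (Fin a → Points k H₀ R) × (Fin b → Rˣ),
    ∀ (R S : Type u) [CommRing R] [Algebra k R] [CommRing S] [Algebra k S] (f : R →ₐ[k] S)
      (x : Points k H R),
      e S (x.map f) =
        (fun i => ((e R x).1 i).map f, fun i => Units.map (f : R →* S) ((e R x).2 i))

end SerreTorus

end

/-! The group Gal(K/k) is generated by σ and has order t. Letting X act as σ makes (K ⊗ R)ˣ a
ℤ[X]-module, functorially in R. For every ℤ[X]-module M the group functor R ↦ Hom(M, (K ⊗ R)ˣ) is
represented by a Hopf algebra, `TorusRing`. Over an extension L of K one has K ⊗ S ≃ S^t with σ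
acting as a cyclic shift, so if X^t is trivial on M, equivariant maps M → (K ⊗ S)ˣ are the same as
plain homomorphisms M → Sˣ. Hence `TorusRing` becomes the group algebra L[M]
(`ofGroupAlgebra_bijective`), and M ≃ ℤ^n gives a torus of dimension n.

The module ℤ[X]/(X^t - 1) gives R_{K/k} 𝔾_m, ℤ[X]/(X - 1) gives 𝔾_m, and ℤ[X]/(Φ_t) gives T₀.
Multiplication by Ψ on the first module factors as the projection onto ℤ[X]/(Φ_t) followed by an
injection. Injections and surjections of modules induce injections and surjections of coordinate
rings (`mapHom_injective`, `mapHom_surjective`), so T₀ is the image of Ψ(σ).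

Finally T₀(k) is the kernel of Φ_t(σ) on Kˣ. The definition of m puts a primitive ℓ^m-th root of
unity z in K (`mem_cyclotomicField`). If σ z = z^s, then Φ_t(σ) z = z^(Φ_t(s)), so z lies in T₀(k)
as soon as ℓ^m divides Φ_t(s). For odd ℓ, s^t ≡ 1 mod ℓ^m and s has exact order t mod ℓ, and
separability of X^t - 1 mod ℓ makes Ψ(s) prime to ℓ (`pow_dvd_eval_cyclotomic`). For ℓ = 2 one can
take s = 1 or s = -1, a root of Φ_t. The subgroup A is the a-th power of the cyclic group generated
by z, inside T₀^a × 𝔾_m^b. -/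

noncomputable section

namespace SerreTorus

open Polynomial

/-! ### The units of K ⊗ R as a ℤ[X]-module. -/

section UnitsModule

variable {k : Type u} [Field k] {K : Type u} [Field K] [Algebra k K] (σ : K ≃ₐ[k] K)
variable (R : Type u) [CommRing R] [Algebra k R] {S : Type u} [CommRing S] [Algebra k S]
  {S' : Type u} [CommRing S'] [Algebra k S']

/-- The endomorphism of the (additively written) group `(K ⊗ R)ˣ` induced by `σ`. -/
def unitsEnd : Module.End ℤ (Additive (K ⊗[k] R)ˣ) :=
  AddMonoidHom.toIntLinearMap (MonoidHom.toAdditive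
    (Units.map (Algebra.TensorProduct.map (σ : K →ₐ[k] K) (AlgHom.id k R) :
      K ⊗[k] R →* K ⊗[k] R)))

/-- The group `(K ⊗ R)ˣ` as a `ℤ[X]`-module, with `X` acting as `σ`. -/
@[nolint unusedArguments]
def UnitsModule (_ : K ≃ₐ[k] K) (R : Type u) [CommRing R] [Algebra k R] : Type u :=
  Additive (K ⊗[k] R)ˣ

instance : AddCommGroup (UnitsModule σ R) := inferInstanceAs (AddCommGroup (Additive (K ⊗[k] R)ˣ))

instance : Module ℤ[X] (UnitsModule σ R) :=
  Module.compHom (Additive (K ⊗[k] R)ˣ) (aeval (unitsEnd σ R)).toRingHom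

variable {R}

/-- A unit of `K ⊗ R`, as an element of the module `UnitsModule σ R`. -/
def UnitsModule.of (u : (K ⊗[k] R)ˣ) : UnitsModule σ R := Additive.ofMul u

variable {σ}

/-- The unit of `K ⊗ R` underlying an element of `UnitsModule σ R`. -/
def UnitsModule.unit (v : UnitsModule σ R) : (K ⊗[k] R)ˣ := Additive.toMul v

namespace UnitsModule

@[simp] lemma unit_of (u : (K ⊗[k] R)ˣ) : (of σ u).unit = u := rfl

@[simp] lemma of_unit (v : UnitsModule σ R) : of σ v.unit = v := rfl

lemma unit_injective : Function.Injective (unit : UnitsModule σ R → _) :=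
  Function.LeftInverse.injective of_unit

@[simp] lemma unit_add (v w : UnitsModule σ R) : (v + w).unit = v.unit * w.unit := rfl

@[simp] lemma unit_zero : (0 : UnitsModule σ R).unit = 1 := rfl

@[simp] lemma unit_neg (v : UnitsModule σ R) : (-v).unit = v.unit⁻¹ := rfl

@[simp] lemma unit_X_smul (v : UnitsModule σ R) :
    ((X : ℤ[X]) • v).unit =
      Units.map (Algebra.TensorProduct.map (σ : K →ₐ[k] K) (AlgHom.id k R) :
        K ⊗[k] R →* K ⊗[k] R) v.unit := by
  change Additive.toMul (aeval (unitsEnd σ R) X v) = _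
  rw [aeval_X]
  rfl

lemma unit_smul (P : ℤ[X]) (v : UnitsModule σ R) :
    (P • v).unit = polyAct k σ P R v.unit := rfl

/-- An additive map between `ℤ[X]`-modules which commutes with `X` is `ℤ[X]`-linear. -/
def _root_.AddMonoidHom.toPolynomialIntLinear {M N : Type*} [AddCommGroup M] [Module ℤ[X] M]
    [AddCommGroup N] [Module ℤ[X] N] (f : M →+ N)
    (hf : ∀ m, f ((X : ℤ[X]) • m) = (X : ℤ[X]) • f m) : M →ₗ[ℤ[X]] N where
  __ := f
  map_smul' p m := by
    simp only [ZeroHom.toFun_eq_coe, AddMonoidHom.toZeroHom_coe, RingHom.id_apply]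
    induction p using Polynomial.induction_on' generalizing m with
    | add p q hp hq => simp [add_smul, hp, hq]
    | monomial n a =>
      induction n generalizing m with
      | zero =>
        rw [monomial_zero_left, eq_intCast, Int.cast_smul_eq_zsmul, Int.cast_smul_eq_zsmul,
          map_zsmul]
      | succ n ih =>
        rw [← monomial_mul_X, mul_smul, mul_smul, ih, hf]

@[simp] lemma _root_.AddMonoidHom.toPolynomialIntLinear_apply {M N : Type*} [AddCommGroup M]
    [Module ℤ[X] M] [AddCommGroup N] [Module ℤ[X] N] (f : M →+ N)
    (hf : ∀ m, f ((X : ℤ[X]) • m) = (X : ℤ[X]) • f m) (m : M) :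
    f.toPolynomialIntLinear hf m = f m := rfl

variable (K) in
/-- The homomorphism of algebras `K ⊗ R → K ⊗ S` induced by `R → S`. -/
def tmap (f : R →ₐ[k] S) : K ⊗[k] R →ₐ[k] K ⊗[k] S :=
  Algebra.TensorProduct.map (AlgHom.id k K) f

@[simp] lemma tmap_tmul (f : R →ₐ[k] S) (x : K) (r : R) : tmap K f (x ⊗ₜ r) = x ⊗ₜ f r := rfl

lemma tmap_tmap (f : R →ₐ[k] S) (g : S →ₐ[k] S') (x : K ⊗[k] R) :
    tmap K g (tmap K f x) = tmap K (g.comp f) x := by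
  induction x with
  | zero => simp
  | tmul => simp
  | add x y hx hy => simp [hx, hy]

variable (σ) in
/-- The map `(K ⊗ R)ˣ → (K ⊗ S)ˣ` induced by `R → S`. -/
def map (f : R →ₐ[k] S) : UnitsModule σ R →ₗ[ℤ[X]] UnitsModule σ S :=
  AddMonoidHom.toPolynomialIntLinear
    (AddMonoidHom.mk' (fun v : UnitsModule σ R => of σ (Units.map (tmap K f : K ⊗[k] R →* K ⊗[k] S)
      v.unit))
      (fun v w => by
        apply unit_injective
        simp))
    (fun v => by
      apply unit_injective
      ext
      simp only [AddMonoidHom.mk'_apply, unit_X_smul, unit_of, Units.coe_map, MonoidHom.coe_coe]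
      induction v.unit.val using TensorProduct.induction_on with
      | zero => simp
      | tmul => simp
      | add x y hx hy => simp [hx, hy])

@[simp] lemma unit_map (f : R →ₐ[k] S) (v : UnitsModule σ R) :
    (map σ f v).unit = Units.map (tmap K f : K ⊗[k] R →* K ⊗[k] S) v.unit := rfl

lemma map_map (f : R →ₐ[k] S) (g : S →ₐ[k] S') (v : UnitsModule σ R) :
    map σ g (map σ f v) = map σ (g.comp f) v := by
  apply unit_injective
  ext
  exact tmap_tmap f g _

lemma map_id (v : UnitsModule σ R) : map σ (AlgHom.id k R) v = v := by
  apply unit_injective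
  ext
  simp [tmap]

end UnitsModule

end UnitsModule

end SerreTorus

end

/-! ### Coordinates on K ⊗ R and the representing ring. -/

noncomputable section

namespace SerreTorus

open Polynomial

section Coordinates

variable {k : Type u} [Field k] {K : Type u} [Field K] [Algebra k K] [FiniteDimensional k K]
variable {R : Type u} [CommRing R] [Algebra k R] {S : Type u} [CommRing S] [Algebra k S]

/-- The `R`-coordinates of an element of `K ⊗ R` in the chosen basis of `K`. -/
def tcoord (i : Fin (Module.finrank k K)) : K ⊗[k] R →ₗ[k] R :=
  (TensorProduct.lid k R).toLinearMap ∘ₗ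
    LinearMap.rTensor R ((Module.finBasis k K).coord i)

@[simp] lemma tcoord_tmul (i : Fin (Module.finrank k K)) (x : K) (r : R) :
    tcoord i (x ⊗ₜ[k] r) = (Module.finBasis k K).repr x i • r := rfl

lemma sum_tcoord (x : K ⊗[k] R) : ∑ i, Module.finBasis k K i ⊗ₜ tcoord i x = x := by
  induction x with
  | zero => simp
  | tmul x r =>
    simp only [tcoord_tmul, ← TensorProduct.smul_tmul, ← TensorProduct.sum_tmul]
    rw [(Module.finBasis k K).sum_repr]
  | add x y hx hy =>
    conv_rhs => rw [← hx, ← hy]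
    simp [TensorProduct.tmul_add, Finset.sum_add_distrib]

lemma tcoord_tmap (f : R →ₐ[k] S) (i : Fin (Module.finrank k K)) (x : K ⊗[k] R) :
    tcoord i (UnitsModule.tmap K f x) = f (tcoord i x) := by
  induction x with
  | zero => simp
  | tmul x r => simp
  | add x y hx hy => simp [hx, hy]

lemma tcoord_sum (r : Fin (Module.finrank k K) → R) (j : Fin (Module.finrank k K)) :
    tcoord j (∑ i, Module.finBasis k K i ⊗ₜ[k] r i) = r j := by
  simp [Finsupp.single_apply]

lemma tcoord_ext {x y : K ⊗[k] R} (h : ∀ i, tcoord i x = tcoord i y) : x = y := by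
  rw [← sum_tcoord x, ← sum_tcoord y]
  simp [h]

end Coordinates

section TorusRing

variable {k : Type u} [Field k] {K : Type u} [Field K] [Algebra k K] [FiniteDimensional k K]
  (σ : K ≃ₐ[k] K) (M : Type) [AddCommGroup M] [Module ℤ[X] M]

variable (k K) in
/-- The polynomial ring in the coordinates of a family of elements of `K` indexed by `M`. -/
abbrev PreTorusRing : Type u := MvPolynomial (M × Fin (Module.finrank k K)) k

variable (k K) {M} in
/-- The generic element of `K` with index `m`. -/
def genericElement (m : M) : K ⊗[k] PreTorusRing k K M :=
  ∑ i, Module.finBasis k K i ⊗ₜ MvPolynomial.X (m, i)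

/-- The equations expressing that a family of elements of `K` indexed by `M` is a homomorphism
which is equivariant with respect to `σ`. -/
inductive TorusRel : K ⊗[k] PreTorusRing k K M → K ⊗[k] PreTorusRing k K M → Prop
  | zero : TorusRel (genericElement k K 0) 1
  | add (m n : M) : TorusRel (genericElement k K (m + n))
      (genericElement k K m * genericElement k K n)
  | smul (m : M) : TorusRel (genericElement k K ((X : ℤ[X]) • m))
      (Algebra.TensorProduct.map (σ : K →ₐ[k] K) (AlgHom.id k _) (genericElement k K m))

/-- The ideal generated by the coordinates of the relations. -/
def torusIdeal : Ideal (PreTorusRing k K M) :=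
  Ideal.span {p | ∃ x y i, TorusRel σ M x y ∧ p = tcoord i x - tcoord i y}

/-- The ring representing the functor `R ↦ Hom_{ℤ[X]}(M, (K ⊗ R)ˣ)`, where `X` acts
on `(K ⊗ R)ˣ` as `σ`. If `K / k` is Galois with group generated by `σ`, then this is the
coordinate ring of the multiplicative group with character module `M`. -/
def TorusRing : Type u := PreTorusRing k K M ⧸ torusIdeal σ M

namespace TorusRing

instance : CommRing (TorusRing σ M) := inferInstanceAs (CommRing (_ ⧸ torusIdeal σ M))

instance : Algebra k (TorusRing σ M) := inferInstanceAs (Algebra k (_ ⧸ torusIdeal σ M))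

/-- The quotient map. -/
def mk : PreTorusRing k K M →ₐ[k] TorusRing σ M := Ideal.Quotient.mkₐ k (torusIdeal σ M)

lemma mk_surjective : Function.Surjective (mk σ M) := Ideal.Quotient.mkₐ_surjective _ _

variable {M}

lemma tmap_mk_eq {x y : K ⊗[k] PreTorusRing k K M} (h : TorusRel σ M x y) :
    UnitsModule.tmap K (mk σ M) x = UnitsModule.tmap K (mk σ M) y := by
  apply tcoord_ext
  intro i
  rw [tcoord_tmap, tcoord_tmap]
  exact Ideal.Quotient.eq.mpr (Ideal.subset_span ⟨x, y, i, h, rfl⟩)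

variable {σ}

variable (M σ) in
/-- The generic homomorphism, with values in the multiplicative monoid of `K ⊗ R`. -/
def genericHom : Multiplicative M →* K ⊗[k] TorusRing σ M where
  toFun m := UnitsModule.tmap K (mk σ M) (genericElement k K m.toAdd)
  map_one' := by simpa using tmap_mk_eq σ TorusRel.zero
  map_mul' m n := by simpa using tmap_mk_eq σ (TorusRel.add m.toAdd n.toAdd)

variable (M σ) in
/-- The universal homomorphism `M → (K ⊗ R)ˣ`. -/
def univ : M →ₗ[ℤ[X]] UnitsModule σ (TorusRing σ M) :=
  AddMonoidHom.toPolynomialIntLinear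
    (AddMonoidHom.mk'
      (fun m : M => UnitsModule.of σ ((genericHom σ M).toHomUnits (Multiplicative.ofAdd m)))
      (fun m n => by
        apply UnitsModule.unit_injective
        simp))
    (fun m => by
      apply UnitsModule.unit_injective
      ext
      simp only [AddMonoidHom.mk'_apply, UnitsModule.unit_X_smul, UnitsModule.unit_of,
        Units.coe_map, MonoidHom.coe_coe, MonoidHom.coe_toHomUnits]
      refine (tmap_mk_eq σ (TorusRel.smul m)).trans ?_
      change _ = Algebra.TensorProduct.map _ _ (UnitsModule.tmap K (mk σ M) (genericElement k K m))
      induction (genericElement k K m) using TensorProduct.induction_on with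
      | zero => simp
      | tmul => simp
      | add x y hx hy => rw [map_add, map_add, hx, hy, map_add, map_add])

lemma unit_univ (m : M) :
    ((univ σ M m).unit : K ⊗[k] TorusRing σ M) =
      UnitsModule.tmap K (mk σ M) (genericElement k K m) := rfl

lemma tcoord_univ (m : M) (i : Fin (Module.finrank k K)) :
    tcoord i ((univ σ M m).unit : K ⊗[k] TorusRing σ M) = mk σ M (MvPolynomial.X (m, i)) := by
  rw [unit_univ, tcoord_tmap, genericElement, tcoord_sum]

variable {R : Type u} [CommRing R] [Algebra k R]

/-- The coordinates of the universal homomorphism generate the ring. This is the uniqueness half of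
representability; the identities between comultiplication, counit and antipode are all checked
through it. -/
lemma hom_ext {f g : TorusRing σ M →ₐ[k] R}
    (h : ∀ m, UnitsModule.map σ f (univ σ M m) = UnitsModule.map σ g (univ σ M m)) : f = g := by
  have key : f.comp (mk σ M) = g.comp (mk σ M) := by
    apply MvPolynomial.algHom_ext
    rintro ⟨m, i⟩
    have := congrArg (fun v => tcoord i (v.unit : K ⊗[k] R)) (h m)
    simpa [tcoord_tmap, tcoord_univ] using this
  ext x
  obtain ⟨p, rfl⟩ := mk_surjective σ M x
  exact DFunLike.congr_fun key p

/-- The homomorphism from the polynomial ring attached to a homomorphism `M → (K ⊗ R)ˣ`. -/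
def preLift (φ : M →ₗ[ℤ[X]] UnitsModule σ R) : PreTorusRing k K M →ₐ[k] R :=
  MvPolynomial.aeval fun p => tcoord p.2 ((φ p.1).unit : K ⊗[k] R)

lemma tmap_preLift (φ : M →ₗ[ℤ[X]] UnitsModule σ R) (m : M) :
    UnitsModule.tmap K (preLift φ) (genericElement k K m) = (φ m).unit := by
  rw [genericElement, map_sum, ← sum_tcoord ((φ m).unit : K ⊗[k] R)]
  simp [preLift]

/-- The homomorphism corresponding to a homomorphism `M → (K ⊗ R)ˣ`. -/
def lift (φ : M →ₗ[ℤ[X]] UnitsModule σ R) : TorusRing σ M →ₐ[k] R :=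
  Ideal.Quotient.liftₐ (torusIdeal σ M) (preLift φ) (by
    intro a ha
    change a ∈ RingHom.ker (preLift φ)
    revert a
    refine Ideal.span_le.mpr ?_
    -- The generators of the ideal die because φ preserves zero, sums and the action of X.
    rintro _ ⟨x, y, i, h, rfl⟩
    change preLift φ _ = 0
    rw [map_sub, sub_eq_zero, ← tcoord_tmap, ← tcoord_tmap]
    congr 1
    cases h with
    | zero => simp [tmap_preLift]
    | add m n => simp [tmap_preLift]
    | smul m =>
      rw [tmap_preLift, map_smul, UnitsModule.unit_X_smul, Units.coe_map, ← tmap_preLift]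
      simp only [MonoidHom.coe_coe]
      induction (genericElement k K m) using TensorProduct.induction_on with
      | zero => simp
      | tmul => simp
      | add x y hx hy => rw [map_add, map_add, hx, hy, map_add, map_add])

@[simp] lemma map_lift_univ (φ : M →ₗ[ℤ[X]] UnitsModule σ R) (m : M) :
    UnitsModule.map σ (lift φ) (univ σ M m) = φ m := by
  apply UnitsModule.unit_injective
  ext
  rw [← tmap_preLift φ, UnitsModule.unit_map, Units.coe_map, MonoidHom.coe_coe, unit_univ,
    UnitsModule.tmap_tmap]
  rfl

end TorusRing

end TorusRing

end SerreTorus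

end

/-! ### The Hopf algebra structure and its functoriality in the character module. -/

noncomputable section

namespace SerreTorus

open Polynomial

namespace TorusRing

variable {k : Type u} [Field k] {K : Type u} [Field K] [Algebra k K] [FiniteDimensional k K]
  (σ : K ≃ₐ[k] K) (M : Type) [AddCommGroup M] [Module ℤ[X] M]

open Algebra.TensorProduct (includeLeft includeRight)

/-- The comultiplication of `TorusRing σ M`. -/
def comulHom : TorusRing σ M →ₐ[k] TorusRing σ M ⊗[k] TorusRing σ M :=
  lift ((UnitsModule.map σ includeLeft).comp (univ σ M) +
    (UnitsModule.map σ includeRight).comp (univ σ M))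

/-- The counit of `TorusRing σ M`. -/
def counitHom : TorusRing σ M →ₐ[k] k := lift 0

/-- The antipode of `TorusRing σ M`. -/
def antipodeHom : TorusRing σ M →ₐ[k] TorusRing σ M := lift (-univ σ M)

variable {σ M}

lemma map_comulHom (m : M) : UnitsModule.map σ (comulHom σ M) (univ σ M m) =
    UnitsModule.map σ includeLeft (univ σ M m) + UnitsModule.map σ includeRight (univ σ M m) := by
  simp [comulHom]

lemma map_counitHom (m : M) : UnitsModule.map σ (counitHom σ M) (univ σ M m) = 0 := by
  simp [counitHom]

lemma map_antipodeHom (m : M) :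
    UnitsModule.map σ (antipodeHom σ M) (univ σ M m) = -univ σ M m := by
  simp [antipodeHom]

variable {R : Type u} [CommRing R] [Algebra k R] {S : Type u} [CommRing S] [Algebra k S]

/-- A point of the tensor square is a pair of points, and comultiplication adds the two
corresponding homomorphisms. This turns each Hopf axiom into a group axiom for homomorphisms out of
M. -/
lemma map_comp_comulHom (f : TorusRing σ M ⊗[k] TorusRing σ M →ₐ[k] R)
    (g h : TorusRing σ M →ₐ[k] R) (hg : ∀ x, f (x ⊗ₜ 1) = g x) (hh : ∀ x, f (1 ⊗ₜ x) = h x)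
    (m : M) : UnitsModule.map σ (f.comp (comulHom σ M)) (univ σ M m) =
      UnitsModule.map σ g (univ σ M m) + UnitsModule.map σ h (univ σ M m) := by
  have h1 : f.comp includeLeft = g := AlgHom.ext hg
  have h2 : f.comp includeRight = h := AlgHom.ext hh
  rw [← UnitsModule.map_map, map_comulHom, map_add, UnitsModule.map_map, UnitsModule.map_map,
    h1, h2]

lemma map_comp_counitHom (f : k →ₐ[k] R) (m : M) :
    UnitsModule.map σ (f.comp (counitHom σ M)) (univ σ M m) = 0 := by
  rw [← UnitsModule.map_map, map_counitHom, map_zero]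

instance : Bialgebra k (TorusRing σ M) :=
  Bialgebra.ofAlgHom (comulHom σ M) (counitHom σ M)
    (by
      apply hom_ext (σ := σ)
      intro m
      let assoc := (Algebra.TensorProduct.assoc k k k (TorusRing σ M) (TorusRing σ M)
        (TorusRing σ M)).toAlgHom
      rw [← AlgHom.comp_assoc, map_comp_comulHom _ ((assoc.comp includeLeft).comp (comulHom σ M))
          (AlgHom.comp includeRight includeRight) (fun _ => rfl)
          (fun x => by simp [Algebra.TensorProduct.one_def]),
        map_comp_comulHom _ includeLeft (AlgHom.comp includeRight includeLeft)
          (fun x => by simp [assoc,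
          Algebra.TensorProduct.one_def]) (fun x => by simp [assoc]),
        map_comp_comulHom _ includeLeft (AlgHom.comp includeRight (comulHom σ M))
          (fun x => by simp) (fun x => by simp),
        map_comp_comulHom _ (AlgHom.comp includeRight includeLeft) (AlgHom.comp includeRight includeRight)
          (fun x => by simp) (fun x => by simp),
        add_assoc])
    (by
      apply hom_ext (σ := σ)
      intro m
      rw [map_comp_comulHom _ (AlgHom.comp includeLeft (counitHom σ M)) includeRight
          (fun _ => by simp) (fun _ => by simp),
        map_comp_counitHom, zero_add]
      rfl)
    (by
      apply hom_ext (σ := σ)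
      intro m
      rw [map_comp_comulHom _ includeLeft (AlgHom.comp includeRight (counitHom σ M)) (fun _ => by simp)
        (fun _ => by simp), map_comp_counitHom, add_zero]
      rfl)

lemma comulAlgHom_eq : Bialgebra.comulAlgHom k (TorusRing σ M) = comulHom σ M := rfl

lemma counitAlgHom_eq : Bialgebra.counitAlgHom k (TorusRing σ M) = counitHom σ M := rfl

instance : HopfAlgebra k (TorusRing σ M) :=
  HopfAlgebra.ofAlgHom (antipodeHom σ M)
    (by
      apply hom_ext (σ := σ)
      intro m
      rw [comulAlgHom_eq, counitAlgHom_eq, map_comp_counitHom]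
      refine (map_comp_comulHom _ (antipodeHom σ M) (AlgHom.id k _)
        (fun _ => (Algebra.TensorProduct.lift_tmul ..).trans (by simp))
        (fun _ => (Algebra.TensorProduct.lift_tmul ..).trans (by simp)) m).trans ?_
      rw [map_antipodeHom, UnitsModule.map_id, neg_add_cancel])
    (by
      apply hom_ext (σ := σ)
      intro m
      rw [comulAlgHom_eq, counitAlgHom_eq, map_comp_counitHom]
      refine (map_comp_comulHom _ (AlgHom.id k _) (antipodeHom σ M)
        (fun _ => (Algebra.TensorProduct.lift_tmul ..).trans (by simp))
        (fun _ => (Algebra.TensorProduct.lift_tmul ..).trans (by simp)) m).trans ?_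
      rw [map_antipodeHom, UnitsModule.map_id, add_neg_cancel])

variable (σ M) in
/-- The multiplicative group with coordinate ring `TorusRing σ M`. -/
def hopf : CommHopfAlgCat.{u} k := CommHopfAlgCat.of k (TorusRing σ M)

lemma map_convMul (x y : WithConv (TorusRing σ M →ₐ[k] R)) (m : M) :
    UnitsModule.map σ (x * y).ofConv (univ σ M m) =
      UnitsModule.map σ x.ofConv (univ σ M m) + UnitsModule.map σ y.ofConv (univ σ M m) := by
  rw [AlgHom.convMul_def, WithConv.ofConv_toConv, ← UnitsModule.map_map, ← UnitsModule.map_map,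
    comulAlgHom_eq, map_comulHom, map_add, map_add]
  simp only [UnitsModule.map_map]
  congr 2
  · congr 1; ext; simp
  · congr 1; ext; simp

/-- The `R`-points of the group with coordinate ring `TorusRing σ M` are the homomorphisms
`M → (K ⊗ R)ˣ`. -/
def pointsEquiv : Points k (hopf σ M) R ≃* Multiplicative (M →ₗ[ℤ[X]] UnitsModule σ R) where
  toFun x := .ofAdd ((UnitsModule.map σ (S := R) (show TorusRing σ M →ₐ[k] R from x.ofConv)).comp
    (univ σ M))
  invFun φ := WithConv.toConv (show TorusRing σ M →ₐ[k] R from lift φ.toAdd)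
  left_inv x := by
    apply WithConv.ofConv_injective
    apply hom_ext (σ := σ)
    intro m
    exact map_lift_univ _ _
  right_inv φ := by
    apply Multiplicative.toAdd.injective
    ext m
    exact map_lift_univ _ _
  map_mul' x y := by
    apply Multiplicative.toAdd.injective
    apply LinearMap.ext
    intro m
    exact map_convMul x y m

/-- The homomorphism `M → (K ⊗ R)ˣ` corresponding to an `R`-point. -/
def pointHom (x : Points k (hopf σ M) R) : M →ₗ[ℤ[X]] UnitsModule σ R := (pointsEquiv x).toAdd

/-- The algebra homomorphism given by an `R`-point. -/
def pointAlgHom (x : Points k (hopf σ M) R) : TorusRing σ M →ₐ[k] R :=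
  show TorusRing σ M →ₐ[k] R from x.ofConv

lemma pointHom_apply (x : Points k (hopf σ M) R) (m : M) :
    pointHom x m = UnitsModule.map σ (pointAlgHom x) (univ σ M m) := rfl

lemma pointHom_injective : Function.Injective (pointHom : Points k (hopf σ M) R → _) :=
  Multiplicative.toAdd.injective.comp pointsEquiv.injective

lemma pointHom_surjective : Function.Surjective (pointHom : Points k (hopf σ M) R → _) :=
  Multiplicative.toAdd.surjective.comp pointsEquiv.surjective

lemma pointHom_mul (x y : Points k (hopf σ M) R) :
    pointHom (x * y) = pointHom x + pointHom y :=
  congrArg Multiplicative.toAdd (map_mul pointsEquiv x y)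

lemma pointHom_map (f : R →ₐ[k] S) (x : Points k (hopf σ M) R) (m : M) :
    pointHom (x.map f) m = UnitsModule.map σ f (pointHom x m) := by
  rw [pointHom_apply, pointHom_apply, UnitsModule.map_map]
  rfl

variable {N : Type} [AddCommGroup N] [Module ℤ[X] N]

/-- The homomorphism of coordinate rings induced by a homomorphism of character modules. -/
def mapAlgHom (g : M →ₗ[ℤ[X]] N) : TorusRing σ M →ₐ[k] TorusRing σ N :=
  lift ((univ σ N).comp g)

lemma map_mapAlgHom (g : M →ₗ[ℤ[X]] N) (m : M) :
    UnitsModule.map σ (mapAlgHom g) (univ σ M m) = univ σ N (g m) := by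
  simp [mapAlgHom]

variable (σ) in
/-- The homomorphism of groups (on coordinate rings) induced by a homomorphism of character
modules. -/
def mapHom (g : M →ₗ[ℤ[X]] N) : hopf σ M →ₐc[k] hopf σ N :=
  show TorusRing σ M →ₐc[k] TorusRing σ N from
  BialgHom.ofAlgHom (mapAlgHom g)
    (by
      apply hom_ext (σ := σ)
      intro m
      rw [counitAlgHom_eq, counitAlgHom_eq, ← UnitsModule.map_map, map_mapAlgHom, map_counitHom,
        map_counitHom])
    (by
      apply hom_ext (σ := σ)
      intro m
      rw [comulAlgHom_eq, comulAlgHom_eq, ← UnitsModule.map_map, ← UnitsModule.map_map,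
        map_mapAlgHom, map_comulHom, map_comulHom, map_add, UnitsModule.map_map,
        UnitsModule.map_map, Algebra.TensorProduct.map_comp_includeLeft,
        Algebra.TensorProduct.map_comp_includeRight, ← UnitsModule.map_map,
        ← UnitsModule.map_map, map_mapAlgHom])

lemma pointHom_push (g : M →ₗ[ℤ[X]] N) (x : Points k (hopf σ N) R) (m : M) :
    pointHom (x.push (mapHom σ g)) m = pointHom x (g m) := by
  rw [pointHom_apply, pointHom_apply, ← map_mapAlgHom, UnitsModule.map_map]
  rfl

/-- The target is generated by coordinates of the universal homomorphism at elements g m, and these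
are images of the coordinates at m. -/
lemma mapHom_surjective (g : M →ₗ[ℤ[X]] N) (hg : Function.Surjective g) :
    Function.Surjective (mapHom σ g) := by
  intro y
  obtain ⟨p, rfl⟩ := mk_surjective σ N y
  change ∃ a, mapAlgHom g a = _
  change mk σ N p ∈ (mapAlgHom g : TorusRing σ M →ₐ[k] TorusRing σ N).range
  induction p using MvPolynomial.induction_on with
  | C a =>
    rw [MvPolynomial.C_eq_algebraMap, AlgHom.commutes]
    exact Subalgebra.algebraMap_mem _ _
  | add p q hp hq => rw [map_add]; exact add_mem hp hq
  | mul_X p i hp =>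
    rw [map_mul]
    refine mul_mem hp ?_
    obtain ⟨n, i⟩ := i
    obtain ⟨m, rfl⟩ := hg n
    rw [← tcoord_univ, ← map_mapAlgHom, UnitsModule.unit_map, Units.coe_map, MonoidHom.coe_coe,
      tcoord_tmap]
    exact ⟨_, rfl⟩

end TorusRing

end SerreTorus

end

/-! ### Splitting K ⊗ S over an extension of K. -/

noncomputable section

namespace SerreTorus

open Polynomial

section Split

variable {k : Type u} [Field k] {K : Type u} [Field K] [Algebra k K]
  (σ : K ≃ₐ[k] K) {L : Type u} [Field L] [Algebra k L] (ι : K →ₐ[k] L)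
  (S : Type u) [CommRing S] [Algebra k S] [Algebra L S] [IsScalarTower k L S]
  {S' : Type u} [CommRing S'] [Algebra k S'] [Algebra L S'] [IsScalarTower k L S']

/-- The `i`-th component `x ⊗ s ↦ ι (σ ^ i x) s` of the isomorphism `K ⊗ S ≃ S ^ t`. -/
def splitHom (i : ℕ) : K ⊗[k] S →ₐ[k] S :=
  Algebra.TensorProduct.lift ((IsScalarTower.toAlgHom k L S).comp
    (ι.comp ((σ ^ i : K ≃ₐ[k] K) : K →ₐ[k] K))) (AlgHom.id k S) (fun _ _ => Commute.all _ _)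

variable {S}

@[simp] lemma splitHom_tmul (i : ℕ) (x : K) (s : S) :
    splitHom σ ι S i (x ⊗ₜ s) = algebraMap L S (ι ((σ ^ i) x)) * s := by
  exact Algebra.TensorProduct.lift_tmul ..

lemma splitHom_act (i : ℕ) (x : K ⊗[k] S) :
    splitHom σ ι S i (Algebra.TensorProduct.map (σ : K →ₐ[k] K) (AlgHom.id k S) x) =
      splitHom σ ι S (i + 1) x := by
  induction x with
  | zero => simp
  | tmul x s => simp [pow_succ]
  | add x y hx hy => rw [map_add, map_add, hx, hy, map_add]

lemma splitHom_tmap (i : ℕ) (f : S →ₐ[L] S') (x : K ⊗[k] S) :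
    splitHom σ ι S' i (UnitsModule.tmap K (f.restrictScalars k) x) = f (splitHom σ ι S i x) := by
  induction x with
  | zero => simp
  | tmul x s => simp
  | add x y hx hy => rw [map_add, map_add, hx, hy, map_add, map_add]

variable [FiniteDimensional k K]

/-- The matrix of the isomorphism `K ⊗ L ≃ L ^ t`. -/
def splitMatrix : Matrix (Fin (Module.finrank k K)) (Fin (Module.finrank k K)) L :=
  Matrix.of fun i j => ι ((σ ^ (i : ℕ)) (Module.finBasis k K j))

/-- Dedekind's independence of characters: the embeddings ι ∘ σ^i, for i below the order of σ, are
distinct, hence linearly independent over L. -/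
lemma isUnit_splitMatrix (hσ : orderOf σ = Module.finrank k K) : IsUnit (splitMatrix σ ι) := by
  rw [← Matrix.linearIndependent_rows_iff_isUnit]
  have hinj : Function.Injective
      (fun i : Fin (Module.finrank k K) => ι.comp ((σ ^ (i : ℕ) : K ≃ₐ[k] K) : K →ₐ[k] K)) := by
    intro i j hij
    have h : σ ^ (i : ℕ) = σ ^ (j : ℕ) := by
      ext x
      exact ι.injective (DFunLike.congr_fun hij x)
    exact Fin.ext (pow_injOn_Iio_orderOf (by simp [hσ]) (by simp [hσ]) h)
  have hli := (linearIndependent_algHom_toLinearMap k K L).comp _ hinj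
  rw [Fintype.linearIndependent_iff] at hli ⊢
  intro c hc
  apply hli
  apply (Module.finBasis k K).ext
  intro j
  have := congrFun hc j
  simpa [splitMatrix] using this

lemma splitHom_bijective (hσ : orderOf σ = Module.finrank k K) : Function.Bijective
    (fun (x : K ⊗[k] S) (i : Fin (Module.finrank k K)) => splitHom σ ι S i x) := by
  set A : Matrix (Fin (Module.finrank k K)) (Fin (Module.finrank k K)) S :=
    (splitMatrix σ ι).map (algebraMap L S) with hA
  have hdet : IsUnit A.det := (Matrix.isUnit_iff_isUnit_det A).mp
    ((isUnit_splitMatrix σ ι hσ).map (algebraMap L S).mapMatrix)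
  have key (x : K ⊗[k] S) : (fun i : Fin (Module.finrank k K) => splitHom σ ι S i x) =
      A.mulVec (fun j => tcoord j x) := by
    ext i
    conv_lhs => rw [← sum_tcoord x]
    simp [hA, Matrix.mulVec, dotProduct, splitMatrix]
  constructor
  · intro x y hxy
    simp only [key] at hxy
    have := congrArg A⁻¹.mulVec hxy
    simp only [Matrix.mulVec_mulVec, Matrix.nonsing_inv_mul A hdet, Matrix.one_mulVec] at this
    exact tcoord_ext (congrFun this)
  · intro w
    refine ⟨∑ i, Module.finBasis k K i ⊗ₜ A⁻¹.mulVec w i, ?_⟩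
    simp only [key, tcoord_sum]
    change A.mulVec (A⁻¹.mulVec w) = w
    rw [Matrix.mulVec_mulVec, Matrix.mul_nonsing_inv A hdet, Matrix.one_mulVec]

lemma splitHom_ext (hσ : orderOf σ = Module.finrank k K) {x y : K ⊗[k] S}
    (h : ∀ i, splitHom σ ι S i x = splitHom σ ι S i y) : x = y :=
  (splitHom_bijective σ ι hσ).1 (funext fun i => h i)

/-- Components are indexed by ℕ with period [K : k], so that σ acts as the shift i ↦ i + 1 without
wrap-around. -/
lemma exists_splitHom_eq (hσ : orderOf σ = Module.finrank k K) (w : ℕ → S)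
    (hw : ∀ i, w (i + Module.finrank k K) = w i) : ∃ x, ∀ i, splitHom σ ι S i x = w i := by
  obtain ⟨x, hx⟩ := (splitHom_bijective σ ι hσ).2 (fun i => w i)
  refine ⟨x, fun i => ?_⟩
  have h1 : splitHom σ ι S i x = splitHom σ ι S (i % Module.finrank k K) x := by
    have h : σ ^ i = σ ^ (i % Module.finrank k K) := by rw [← hσ, pow_mod_orderOf]
    simp only [splitHom, h]
  have h2 : w i = w (i % Module.finrank k K) :=
    ((show Function.Periodic w _ from hw).map_mod_nat i).symm
  rw [h1, h2]
  exact congrFun hx ⟨i % Module.finrank k K, Nat.mod_lt _ Module.finrank_pos⟩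

section Hom

variable {M : Type} [AddCommGroup M] [Module ℤ[X] M]

omit [FiniteDimensional k K] in
lemma splitHom_X_pow_smul (v : UnitsModule σ S) (i : ℕ) :
    splitHom σ ι S 0 ((X ^ i : ℤ[X]) • v).unit = splitHom σ ι S i v.unit := by
  have h (j : ℕ) : splitHom σ ι S j ((X ^ i : ℤ[X]) • v).unit =
      splitHom σ ι S (i + j) v.unit := by
    induction i generalizing j with
    | zero => simp
    | succ i ih =>
      rw [pow_succ', mul_smul, UnitsModule.unit_X_smul, Units.coe_map, MonoidHom.coe_coe,
        splitHom_act, ih, add_assoc, add_comm j]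
  simpa using h 0

/-- The i-th component of φ m is the zeroth component of φ (X^i m), so the zeroth component
determines everything. -/
lemma equivariantHom_ext (hσ : orderOf σ = Module.finrank k K)
    {φ ψ : M →ₗ[ℤ[X]] UnitsModule σ S}
    (h : ∀ m, splitHom σ ι S 0 (φ m).unit = splitHom σ ι S 0 (ψ m).unit) : φ = ψ := by
  ext m
  apply UnitsModule.unit_injective
  ext
  apply splitHom_ext σ ι hσ
  intro i
  rw [← splitHom_X_pow_smul σ ι (φ m), ← splitHom_X_pow_smul σ ι (ψ m), ← map_smul, ← map_smul, h]

/-- The module (K ⊗ S)ˣ is coinduced from Sˣ: prescribe θ (X^i m) as the i-th component of φ m. The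
hypothesis `hM` supplies the periodicity this requires. -/
lemma exists_equivariantHom (hσ : orderOf σ = Module.finrank k K)
    (hM : ∀ m : M, (X ^ Module.finrank k K : ℤ[X]) • m = m) (θ : Multiplicative M →* S) :
    ∃ φ : M →ₗ[ℤ[X]] UnitsModule σ S,
      ∀ m, splitHom σ ι S 0 (φ m).unit = θ (Multiplicative.ofAdd m) := by
  choose x hx using fun m : M => exists_splitHom_eq σ ι hσ
    (fun i => θ (Multiplicative.ofAdd ((X ^ i : ℤ[X]) • m)))
    (fun i => by simp only [pow_add, mul_smul, hM])
  let Φ : Multiplicative M →* K ⊗[k] S :=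
    { toFun m := x m.toAdd
      map_one' := splitHom_ext σ ι hσ fun i => by simp [hx]
      map_mul' m n := splitHom_ext σ ι hσ fun i => by simp [hx, smul_add] }
  refine ⟨AddMonoidHom.toPolynomialIntLinear (AddMonoidHom.mk'
    (fun m : M => UnitsModule.of σ (Φ.toHomUnits (Multiplicative.ofAdd m))) fun m n => ?_)
      fun m => ?_, fun m => ?_⟩
  · apply UnitsModule.unit_injective
    simp
  · apply UnitsModule.unit_injective
    ext
    apply splitHom_ext σ ι hσ
    intro i
    simp only [AddMonoidHom.mk'_apply, UnitsModule.unit_X_smul, UnitsModule.unit_of,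
      Units.coe_map, MonoidHom.coe_coe, MonoidHom.coe_toHomUnits, splitHom_act]
    change splitHom σ ι S i (x ((X : ℤ[X]) • m)) = splitHom σ ι S (i + 1) (x m)
    rw [hx, hx, pow_succ, mul_smul]
  · change splitHom σ ι S 0 (x m) = _
    simp [hx]

end Hom

end Split

end SerreTorus

end

/-! ### Base change to a splitting field: the group algebra of M. -/

noncomputable section

namespace SerreTorus

open Polynomial

namespace TorusRing

open Algebra.TensorProduct (includeLeft includeRight)

lemma groupAlgebra_algHom_ext {L : Type u} [Field L] {M : Type} [AddCommGroup M]
    {A : Type*} [Semiring A] [Algebra L A]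
    {f g : AddMonoidAlgebra L M →ₐ[L] A}
    (h : ∀ m, f (AddMonoidAlgebra.single m 1) = g (AddMonoidAlgebra.single m 1)) : f = g :=
  AddMonoidAlgebra.algHom_ext h (by ext)

variable {k : Type u} [Field k] {K : Type u} [Field K] [Algebra k K] [FiniteDimensional k K]
  (σ : K ≃ₐ[k] K) {L : Type u} [Field L] [Algebra k L] (ι : K →ₐ[k] L)
  {M : Type} [AddCommGroup M] [Module ℤ[X] M] {N : Type} [AddCommGroup N] [Module ℤ[X] N]

variable (L M) in
/-- The inclusion of `TorusRing σ M` in its base change. -/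
abbrev toBaseChange : TorusRing σ M →ₐ[k] L ⊗[k] TorusRing σ M := includeRight

/-- The characters of the base change of `TorusRing σ M` to a splitting field. -/
def character : Multiplicative M →* L ⊗[k] TorusRing σ M where
  toFun m := splitHom σ ι _ 0 (UnitsModule.map σ (toBaseChange σ L M) (univ σ M m.toAdd)).unit.val
  map_one' := by simp
  map_mul' m n := by simp

lemma character_apply (m : M) : character σ ι (Multiplicative.ofAdd m) =
    splitHom σ ι (L ⊗[k] TorusRing σ M) 0
      (UnitsModule.map σ (toBaseChange σ L M) (univ σ M m)).unit.val := rfl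

lemma algHom_character {S : Type u} [CommRing S] [Algebra k S] [Algebra L S]
    [IsScalarTower k L S] (f : L ⊗[k] TorusRing σ M →ₐ[L] S) (m : M) :
    f (character σ ι (Multiplicative.ofAdd m)) = splitHom σ ι S 0
      (UnitsModule.map σ ((f.restrictScalars k).comp (toBaseChange σ L M)) (univ σ M m)).unit.val := by
  rw [character_apply, ← splitHom_tmap, ← UnitsModule.map_map]
  rfl

/-- The homomorphism from the group algebra to the base change of `TorusRing σ M`. -/
def ofGroupAlgebra : AddMonoidAlgebra L M →ₐ[L] L ⊗[k] TorusRing σ M :=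
  AddMonoidAlgebra.lift L _ M (character σ ι)

@[simp] lemma ofGroupAlgebra_single (m : M) :
    ofGroupAlgebra σ ι (AddMonoidAlgebra.single m 1) =
      character σ ι (Multiplicative.ofAdd m) := by
  simp [ofGroupAlgebra]

lemma ofGroupAlgebra_bijective (hσ : orderOf σ = Module.finrank k K)
    (hM : ∀ m : M, (X ^ Module.finrank k K : ℤ[X]) • m = m) :
    Function.Bijective (ofGroupAlgebra σ ι : AddMonoidAlgebra L M →ₐ[L] _) := by
  -- The inverse map is the point with values in L[M] whose zeroth component is the tautological
  -- character of M.
  obtain ⟨φ, hφ⟩ := exists_equivariantHom σ ι hσ hM (AddMonoidAlgebra.of L M)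
  let β : L ⊗[k] TorusRing σ M →ₐ[L] AddMonoidAlgebra L M :=
    Algebra.TensorProduct.lift (Algebra.ofId L _) (lift φ) (fun _ _ => Commute.all _ _)
  have hβ : (β.restrictScalars k).comp (toBaseChange σ L M) = lift φ := by
    ext x
    simp [β]
  have h1 : β.comp (ofGroupAlgebra σ ι) = AlgHom.id L _ := by
    apply groupAlgebra_algHom_ext
    intro m
    rw [AlgHom.comp_apply, ofGroupAlgebra_single, algHom_character, hβ, map_lift_univ, hφ]
    rfl
  have h2 : (ofGroupAlgebra σ ι).comp β = AlgHom.id L _ := by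
    apply Algebra.TensorProduct.ext
    · ext
    · apply hom_ext (σ := σ)
      have := equivariantHom_ext σ ι hσ
        (φ := (UnitsModule.map σ ((ofGroupAlgebra σ ι).restrictScalars k)).comp φ)
        (ψ := (UnitsModule.map σ (toBaseChange σ L M)).comp (univ σ M)) (fun m => by
          rw [LinearMap.comp_apply, LinearMap.comp_apply, UnitsModule.unit_map, Units.coe_map,
            MonoidHom.coe_coe, splitHom_tmap, hφ, ← character_apply]
          exact ofGroupAlgebra_single σ ι m)
      intro m
      have h3 := LinearMap.congr_fun this m
      rw [LinearMap.comp_apply, LinearMap.comp_apply, ← map_lift_univ φ, UnitsModule.map_map] at h3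
      convert h3 using 2
      · rw [← hβ]
        rfl
      · rfl
  exact ⟨Function.LeftInverse.injective (DFunLike.congr_fun h1),
    Function.RightInverse.surjective (DFunLike.congr_fun h2)⟩

/-- Counit and comultiplication send the universal homomorphism to zero and to the sum of its two
copies; taking zeroth components gives 1 and a ⊗ a. -/
lemma isGroupLikeElem_character (m : M) :
    IsGroupLikeElem L (character σ ι (Multiplicative.ofAdd m)) where
  counit_eq_one := by
    change Bialgebra.counitAlgHom L (L ⊗[k] TorusRing σ M) _ = 1
    rw [algHom_character]
    have : ((Bialgebra.counitAlgHom L (L ⊗[k] TorusRing σ M)).restrictScalars k).comp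
        (toBaseChange σ L M) = (Algebra.ofId k L).comp (counitHom σ M) := by
      ext x
      simp [Algebra.ofId_apply, Algebra.algebraMap_eq_smul_one]
      rfl
    rw [this, map_comp_counitHom]
    simp
  comul_eq_tmul_self := by
    change Bialgebra.comulAlgHom L (L ⊗[k] TorusRing σ M) _ = _
    rw [algHom_character]
    let S := L ⊗[k] TorusRing σ M
    let jl : S →ₐ[L] S ⊗[L] S := includeLeft
    let jr : S →ₐ[L] S ⊗[L] S := includeRight
    let i : TorusRing σ M →ₐ[k] S := includeRight
    let j : TorusRing σ M ⊗[k] TorusRing σ M →ₐ[k] S ⊗[L] S :=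
      Algebra.TensorProduct.lift ((jl.restrictScalars k).comp i)
        ((jr.restrictScalars k).comp i) (fun _ _ => Commute.all _ _)
    have : ((Bialgebra.comulAlgHom L (L ⊗[k] TorusRing σ M)).restrictScalars k).comp
        (toBaseChange σ L M) = j.comp (comulHom σ M) := by
      ext x
      have hx : Coalgebra.comul (R := L) ((1 : L) ⊗ₜ[k] x) = j (Coalgebra.comul (R := k) x) := by
        rw [TensorProduct.comul_tmul]
        induction Coalgebra.comul (R := k) x with
        | zero => simp
        | tmul a b => simp [j, jl, jr]; rfl
        | add a b ha hb => rw [TensorProduct.tmul_add, map_add, ha, hb, map_add]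
      exact hx
    rw [this, map_comp_comulHom j ((jl.restrictScalars k).comp i) ((jr.restrictScalars k).comp i)
      (fun x => by simp [j]) (fun x => by simp [j])]
    rw [UnitsModule.unit_add, Units.val_mul, map_mul, ← algHom_character, ← algHom_character]
    simp [jl, jr]

/-- The base change of `TorusRing σ M` to a splitting field is the group algebra of `M`. -/
def groupAlgebraEquiv (hσ : orderOf σ = Module.finrank k K)
    (hM : ∀ m : M, (X ^ Module.finrank k K : ℤ[X]) • m = m) :
    AddMonoidAlgebra L M ≃ₐc[L] L ⊗[k] TorusRing σ M :=
  BialgEquiv.ofAlgEquiv (AlgEquiv.ofBijective (ofGroupAlgebra σ ι)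
    (ofGroupAlgebra_bijective σ ι hσ hM))
    (by
      apply groupAlgebra_algHom_ext
      intro m
      simpa using (isGroupLikeElem_character σ ι m).counit_eq_one)
    (by
      apply groupAlgebra_algHom_ext
      intro m
      simpa using (isGroupLikeElem_character σ ι m).comul_eq_tmul_self.symm)

lemma isTorus_hopf (hσ : orderOf σ = Module.finrank k K)
    (hM : ∀ m : M, (X ^ Module.finrank k K : ℤ[X]) • m = m) (ι : K →ₐ[k] SeparableClosure k)
    {n : ℕ} (e : M ≃+ (Fin n → ℤ)) : IsTorus k n (hopf σ M) :=
  ⟨((groupAlgebraEquiv σ ι hσ hM).symm).trans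
    (AddMonoidAlgebra.domCongrBialgEquiv (SeparableClosure k) (SeparableClosure k) e)⟩

-- Over L the map becomes L[M] → L[N] induced by an injection of groups, hence is injective; the
-- coordinate rings embed in their base changes.
include ι in
lemma mapHom_injective (hσ : orderOf σ = Module.finrank k K)
    (hM : ∀ m : M, (X ^ Module.finrank k K : ℤ[X]) • m = m)
    (hN : ∀ m : N, (X ^ Module.finrank k K : ℤ[X]) • m = m) (g : M →ₗ[ℤ[X]] N)
    (hg : Function.Injective g) : Function.Injective (mapHom σ g) := by
  let G : L ⊗[k] TorusRing σ M →ₐ[L] L ⊗[k] TorusRing σ N :=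
    Algebra.TensorProduct.map (AlgHom.id L L) (mapAlgHom g)
  have hG : G.comp (ofGroupAlgebra σ ι) =
      (ofGroupAlgebra σ ι).comp (AddMonoidAlgebra.mapDomainAlgHom L L g.toAddMonoidHom) := by
    apply groupAlgebra_algHom_ext
    intro m
    have : (G.restrictScalars k).comp (toBaseChange σ L M) = (toBaseChange σ L N).comp (mapAlgHom g) := by
      ext x
      simp [G]
    rw [AlgHom.comp_apply, ofGroupAlgebra_single, algHom_character, this, ← UnitsModule.map_map,
      map_mapAlgHom, ← character_apply]
    simp
  have hinj : Function.Injective G := by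
    have h1 : Function.Injective (G.comp (ofGroupAlgebra σ ι)) := by
      rw [hG]
      exact (ofGroupAlgebra_bijective σ ι hσ hN).1.comp (AddMonoidAlgebra.mapDomain_injective hg)
    exact (Function.Injective.of_comp_iff' (f := G) (ofGroupAlgebra_bijective σ ι hσ hM)).mp h1
  intro x y hxy
  apply Algebra.TensorProduct.includeRight_injective (R := k) (A := L) (B := TorusRing σ M)
    (algebraMap k L).injective
  apply hinj
  have hG' (x : TorusRing σ M) : G (includeRight x) = 1 ⊗ₜ mapAlgHom g x := by simp [G]
  exact (hG' x).trans ((congrArg _ hxy).trans (hG' y).symm)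

end TorusRing

end SerreTorus

end

/-! ### The character modules ℤ[X]/(f), and the fixed points of σ. -/

noncomputable section

namespace SerreTorus

open Polynomial

section CharMod

/-- The `ℤ[X]`-module `ℤ[X] / (f)`. -/
abbrev CharMod (f : ℤ[X]) : Type := ℤ[X] ⧸ Ideal.span {f}

namespace CharMod

lemma smul_eq_zero (f : ℤ[X]) (m : CharMod f) : f • m = 0 := by
  obtain ⟨p, rfl⟩ := Ideal.Quotient.mk_surjective m
  rw [← Ideal.Quotient.mk_eq_mk, ← Submodule.Quotient.mk_smul]
  exact (Submodule.Quotient.mk_eq_zero _).mpr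
    (Ideal.mul_mem_right _ _ (Ideal.mem_span_singleton_self f))

lemma X_pow_smul {f : ℤ[X]} {n : ℕ} (h : f ∣ X ^ n - 1) (m : CharMod f) :
    (X ^ n : ℤ[X]) • m = m := by
  obtain ⟨g, hg⟩ := h
  have : (X ^ n - 1 : ℤ[X]) • m = 0 := by rw [hg, mul_comm, mul_smul, smul_eq_zero, smul_zero]
  rwa [sub_smul, one_smul, sub_eq_zero] at this

/-- The group `ℤ[X] / (f)` is free of rank `deg f` when `f` is monic. -/
def equivFun {f : ℤ[X]} (hf : f.Monic) : CharMod f ≃+ (Fin f.natDegree → ℤ) :=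
  show AdjoinRoot f ≃+ _ from (AdjoinRoot.powerBasis' hf).basis.equivFun.toAddEquiv

/-- Both sides are free abelian groups of the same rank. -/
lemma nonempty_prod_equiv {f g : ℤ[X]} (hf : f.Monic) (hg : g.Monic) (a b : ℕ) :
    Nonempty (((Fin a → CharMod f) × (Fin b → CharMod g)) ≃+
      (Fin (a * f.natDegree + b * g.natDegree) → ℤ)) := by
  let e := (AddEquiv.prodCongr (AddEquiv.piCongrRight fun _ : Fin a => equivFun hf)
    (AddEquiv.piCongrRight fun _ : Fin b => equivFun hg))
  have h : Module.finrank ℤ ((Fin a → Fin f.natDegree → ℤ) × (Fin b → Fin g.natDegree → ℤ)) =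
      a * f.natDegree + b * g.natDegree := by
    simp [Module.finrank_pi_fintype]
  exact ⟨e.trans (Module.finBasisOfFinrankEq ℤ _ h).equivFun.toAddEquiv⟩

lemma hom_ext {f : ℤ[X]} {N : Type*} [AddCommGroup N] [Module ℤ[X] N]
    {φ ψ : CharMod f →ₗ[ℤ[X]] N} (h : φ 1 = ψ 1) : φ = ψ := by
  apply Submodule.linearMap_qext
  apply LinearMap.ext_ring
  exact h

lemma exists_hom {f : ℤ[X]} {N : Type*} [AddCommGroup N] [Module ℤ[X] N] (v : N)
    (hv : f • v = 0) : ∃ φ : CharMod f →ₗ[ℤ[X]] N, φ 1 = v := by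
  refine ⟨Submodule.liftQ _ (LinearMap.toSpanSingleton ℤ[X] N v) ?_, ?_⟩
  · refine (Ideal.span_singleton_le_iff_mem _).mpr ?_
    simpa using hv
  · exact (Submodule.liftQ_apply _ _ (1 : ℤ[X])).trans (by simp)

/-- Multiplication by `g`, as a map from `ℤ[X] / (f)` to `ℤ[X] / (g f)`. -/
def mulLeft (f g : ℤ[X]) : CharMod f →ₗ[ℤ[X]] CharMod (g * f) :=
  Submodule.mapQ (Ideal.span {f}) (Ideal.span {g * f}) (LinearMap.mulLeft ℤ[X] g) (by
    refine (Ideal.span_singleton_le_iff_mem _).mpr ?_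
    exact Ideal.mem_span_singleton_self _)

lemma mulLeft_one (f g : ℤ[X]) : mulLeft f g 1 = g • 1 := by
  rw [mulLeft]
  refine (Submodule.mapQ_apply _ _ _ (1 : ℤ[X])).trans ?_
  simp only [LinearMap.mulLeft_apply]
  rfl

lemma mulLeft_injective (f : ℤ[X]) {g : ℤ[X]} (hg : g ≠ 0) :
    Function.Injective (mulLeft f g) := by
  rw [injective_iff_map_eq_zero]
  intro m hm
  obtain ⟨p, rfl⟩ := Ideal.Quotient.mk_surjective m
  have h : Ideal.Quotient.mk (Ideal.span {g * f}) (g * p) = 0 := hm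
  rw [Ideal.Quotient.eq_zero_iff_mem, Ideal.mem_span_singleton] at h ⊢
  exact (mul_dvd_mul_iff_left hg).mp h

/-- The projection from `ℤ[X] / (g f)` to `ℤ[X] / (f)`. -/
def proj (f g : ℤ[X]) : CharMod (g * f) →ₗ[ℤ[X]] CharMod f :=
  Submodule.mapQ (Ideal.span {g * f}) (Ideal.span {f}) LinearMap.id
    (Ideal.span_singleton_le_span_singleton.mpr (dvd_mul_left f g))

lemma proj_one (f g : ℤ[X]) : proj f g 1 = 1 := rfl

lemma proj_surjective (f g : ℤ[X]) : Function.Surjective (proj f g) := by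
  intro m
  obtain ⟨p, rfl⟩ := Ideal.Quotient.mk_surjective m
  exact ⟨Ideal.Quotient.mk _ p, rfl⟩

end CharMod

end CharMod

section FixedPoints

variable {k : Type u} [Field k] {K : Type u} [Field K] [Algebra k K] {σ : K ≃ₐ[k] K}
  {R : Type u} [CommRing R] [Algebra k R]

variable (k K R) in
/-- The inclusion of `R` in `K ⊗ R`. -/
abbrev incl : R →ₐ[k] K ⊗[k] R := Algebra.TensorProduct.includeRight

variable (k K R) in
lemma incl_injective : Function.Injective (incl k K R) :=
  Algebra.TensorProduct.includeRight_injective (algebraMap k K).injective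

/-- The kernel of σ - 1 on K is k, and tensoring with the flat k-module R preserves this exactness.
-/
lemma exists_eq_incl (hσ : ∀ x : K, σ x = x → x ∈ Set.range (algebraMap k K)) {x : K ⊗[k] R}
    (hx : Algebra.TensorProduct.map (σ : K →ₐ[k] K) (AlgHom.id k R) x = x) :
    ∃ r, incl k K R r = x := by
  let g : K →ₗ[k] K := (σ : K →ₐ[k] K).toLinearMap - LinearMap.id
  have hex : Function.Exact (Algebra.linearMap k K) g := by
    intro y
    constructor
    · intro hy
      exact hσ y (sub_eq_zero.mp hy)
    · rintro ⟨c, rfl⟩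
      simp [g]
  have h2 : LinearMap.rTensor R g x = 0 := by
    rw [LinearMap.rTensor_sub, LinearMap.sub_apply, LinearMap.rTensor_id, LinearMap.id_apply,
      sub_eq_zero]
    exact hx
  obtain ⟨y, rfl⟩ := (Module.Flat.rTensor_exact R hex x).mp h2
  obtain ⟨r, rfl⟩ := (TensorProduct.lid k R).symm.surjective y
  exact ⟨r, by simp⟩

lemma exists_units_eq_incl (hσ : ∀ x : K, σ x = x → x ∈ Set.range (algebraMap k K))
    {v : UnitsModule σ R} (hv : (X : ℤ[X]) • v = v) :
    ∃ r : Rˣ, Units.map (incl k K R : R →* K ⊗[k] R) r = v.unit := by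
  have key (v : UnitsModule σ R) (hv : (X : ℤ[X]) • v = v) : ∃ r, incl k K R r = v.unit := by
    apply exists_eq_incl hσ
    conv_rhs => rw [← hv]
    rw [UnitsModule.unit_X_smul]
    rfl
  obtain ⟨r, hr⟩ := key v hv
  -- The inverse unit is fixed too, so it also descends; its descent is the inverse in R.
  obtain ⟨s, hs⟩ := key (-v) (by rw [smul_neg, hv])
  have hrs : r * s = 1 := by
    apply incl_injective k K R
    rw [map_mul, hr, hs, map_one, UnitsModule.unit_neg, Units.mul_inv]
  refine ⟨⟨r, s, hrs, by rw [mul_comm, hrs]⟩, ?_⟩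
  ext
  exact hr

lemma unit_X_pow_smul (v : UnitsModule σ R) (n : ℕ) :
    (((X ^ n : ℤ[X]) • v).unit : K ⊗[k] R) =
      Algebra.TensorProduct.map ((σ ^ n : K ≃ₐ[k] K) : K →ₐ[k] K) (AlgHom.id k R)
        (v.unit : K ⊗[k] R) := by
  induction n with
  | zero =>
    rw [pow_zero, pow_zero, one_smul]
    exact (DFunLike.congr_fun (Algebra.TensorProduct.map_id (R := k) (S := k) (A := K) (B := R))
      _).symm
  | succ n ih =>
    rw [pow_succ', mul_smul, UnitsModule.unit_X_smul, Units.coe_map, MonoidHom.coe_coe, ih]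
    induction (v.unit : K ⊗[k] R) using TensorProduct.induction_on with
    | zero => simp
    | tmul x s => simp [pow_succ']
    | add x y hx hy => rw [map_add, map_add, hx, hy, map_add]

lemma X_pow_orderOf_smul (v : UnitsModule σ R) : (X ^ orderOf σ : ℤ[X]) • v = v := by
  apply UnitsModule.unit_injective
  ext
  rw [unit_X_pow_smul, pow_orderOf_eq_one]
  exact DFunLike.congr_fun (Algebra.TensorProduct.map_id (R := k) (S := k) (A := K) (B := R)) _

end FixedPoints

end SerreTorus

end

/-! ### The Weil restriction and the image of P(σ). -/

noncomputable section

namespace SerreTorus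

open Polynomial TorusRing

section

variable {k : Type u} [Field k] {K : Type u} [Field K] [Algebra k K] [FiniteDimensional k K]
  (σ : K ≃ₐ[k] K)

/-- The `R`-points of the group with character module `ℤ[X] / (X ^ t - 1)`, where `t` is the
order of `σ`, are the units of `K ⊗ R`. -/
def weilEquiv {f : ℤ[X]} (hf : f = X ^ orderOf σ - 1) (R : Type u) [CommRing R] [Algebra k R] :
    Points k (hopf σ (CharMod f)) R ≃* (K ⊗[k] R)ˣ :=
  MulEquiv.ofBijective
    (⟨fun x => (pointHom x 1).unit, fun x y => by simp [pointHom_mul]⟩ :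
      Points k (hopf σ (CharMod f)) R →ₙ* (K ⊗[k] R)ˣ)
    (by
      constructor
      · intro x y hxy
        exact pointHom_injective (CharMod.hom_ext (UnitsModule.unit_injective hxy))
      · intro u
        obtain ⟨φ, hφ⟩ := CharMod.exists_hom (f := f) (UnitsModule.of σ u) (by
          rw [hf, sub_smul, one_smul, X_pow_orderOf_smul, sub_self])
        obtain ⟨x, rfl⟩ := pointHom_surjective φ
        exact ⟨x, by simp [hφ]⟩)

lemma weilEquiv_apply {f : ℤ[X]} (hf : f = X ^ orderOf σ - 1) {R : Type u} [CommRing R]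
    [Algebra k R] (x : Points k (hopf σ (CharMod f)) R) :
    weilEquiv σ hf R x = (pointHom x 1).unit := rfl

lemma isWeilRestrictionGm_hopf {f : ℤ[X]} (hf : f = X ^ orderOf σ - 1) :
    IsWeilRestrictionGm k K (hopf σ (CharMod f)) (weilEquiv σ hf) := by
  intro R S _ _ _ _ g x
  rw [weilEquiv_apply, weilEquiv_apply, pointHom_map]
  rfl

/-- On ℤ[X]/(gf), multiplication by g is the projection to ℤ[X]/(f) followed by the injection m ↦ g
m. Dually, the injection gives the quotient map onto T₀ and the projection gives the closed
immersion. -/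
lemma isImagePolyAct_hopf (hσ : orderOf σ = Module.finrank k K) {L : Type u} [Field L]
    [Algebra k L] (ι : K →ₐ[k] L) {f g : ℤ[X]} (hfg : g * f = X ^ orderOf σ - 1) (hg : g ≠ 0) :
    IsImagePolyAct k σ g (hopf σ (CharMod f)) := by
  refine ⟨hopf σ (CharMod (g * f)), weilEquiv σ hfg, mapHom σ (CharMod.mulLeft f g),
    mapHom σ (CharMod.proj f g), isWeilRestrictionGm_hopf σ hfg, ?_,
    mapHom_surjective _ (CharMod.proj_surjective f g), ?_⟩
  · refine mapHom_injective σ ι hσ ?_ ?_ _ (CharMod.mulLeft_injective f hg)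
    · exact CharMod.X_pow_smul (by rw [← hσ, ← hfg]; exact dvd_mul_left f g)
    · exact CharMod.X_pow_smul (by rw [← hσ, ← hfg])
  · intro R _ _ x
    rw [weilEquiv_apply, weilEquiv_apply, pointHom_push, pointHom_push, CharMod.proj_one,
      CharMod.mulLeft_one, map_smul, UnitsModule.unit_smul]

end

/-! ### The products T₀^a × 𝔾_m^b and their finite subgroups. -/

section Product

variable {k : Type u} [Field k] {K : Type u} [Field K] [Algebra k K] [FiniteDimensional k K]
  (σ : K ≃ₐ[k] K) (f : ℤ[X]) (a b : ℕ)

/-- The character module of the product `T₀ ^ a × 𝔾_m ^ b`. -/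
abbrev ProdMod : Type := (Fin a → CharMod f) × (Fin b → CharMod (X - 1))

namespace ProdMod

variable {f a b}

/-- The inclusion of the `i`-th nontrivial summand. -/
def inc (i : Fin a) : CharMod f →ₗ[ℤ[X]] ProdMod f a b :=
  LinearMap.inl ℤ[X] _ _ ∘ₗ LinearMap.single ℤ[X] (fun _ => CharMod f) i

/-- The generator of the `j`-th trivial summand. -/
def gen (j : Fin b) : ProdMod f a b :=
  LinearMap.inr ℤ[X] _ _ (LinearMap.single ℤ[X] (fun _ => CharMod (X - 1)) j 1)

lemma X_smul_gen (j : Fin b) : (X : ℤ[X]) • (gen j : ProdMod f a b) = gen j := by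
  rw [gen, ← map_smul, ← map_smul]
  congr 2
  have := CharMod.X_pow_smul (f := X - 1) (n := 1) (by simp) 1
  simpa using this

lemma hom_ext {N : Type*} [AddCommGroup N] [Module ℤ[X] N] {φ ψ : ProdMod f a b →ₗ[ℤ[X]] N}
    (h1 : ∀ i m, φ (inc i m) = ψ (inc i m)) (h2 : ∀ j, φ (gen j) = ψ (gen j)) : φ = ψ := by
  apply LinearMap.prod_ext
  · apply LinearMap.pi_ext'
    intro i
    exact LinearMap.ext (h1 i)
  · apply LinearMap.pi_ext'
    intro j
    exact CharMod.hom_ext (h2 j)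

lemma exists_hom {N : Type*} [AddCommGroup N] [Module ℤ[X] N]
    (φ : Fin a → CharMod f →ₗ[ℤ[X]] N) (v : Fin b → N) (hv : ∀ j, (X : ℤ[X]) • v j = v j) :
    ∃ ψ : ProdMod f a b →ₗ[ℤ[X]] N, (∀ i m, ψ (inc i m) = φ i m) ∧ ∀ j, ψ (gen j) = v j := by
  choose χ hχ using fun j => CharMod.exists_hom (f := X - 1) (v j)
    (by rw [sub_smul, one_smul, hv, sub_self])
  refine ⟨LinearMap.coprod (LinearMap.lsum ℤ[X] _ ℤ φ) (LinearMap.lsum ℤ[X] _ ℤ χ), ?_, ?_⟩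
  · intro i m
    simp [inc, Pi.single_apply, apply_ite]
  · intro j
    rw [gen, LinearMap.coprod_apply]
    simp only [LinearMap.inr_apply, map_zero, zero_add]
    exact (LinearMap.lsum_piSingle ..).trans (hχ j)

end ProdMod

variable {σ f a b}

lemma exists_units_incl_eq_gen (hσ : ∀ x : K, σ x = x → x ∈ Set.range (algebraMap k K))
    (j : Fin b) : ∃ w : (TorusRing σ (ProdMod f a b))ˣ,
      Units.map (incl k K (TorusRing σ (ProdMod f a b)) :
        TorusRing σ (ProdMod f a b) →* K ⊗[k] TorusRing σ (ProdMod f a b)) w =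
        (univ σ (ProdMod f a b) (ProdMod.gen j)).unit :=
  exists_units_eq_incl hσ (by rw [← map_smul, ProdMod.X_smul_gen])

/-- The `R`-points of the group with character module `ProdMod f a b`. -/
lemma isProduct_hopf (hσ : ∀ x : K, σ x = x → x ∈ Set.range (algebraMap k K)) :
    IsProduct k (hopf σ (CharMod f)) a b (hopf σ (ProdMod f a b)) := by
  -- The value of the universal homomorphism on a generator fixed by X descends to a unit of the
  -- coordinate ring itself. Evaluating this unit at a point gives the 𝔾_m-coordinate, and
  -- naturality in R is then automatic.
  choose w hw using exists_units_incl_eq_gen (σ := σ) (f := f) (a := a) (b := b) hσ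
  have hx {R : Type u} [CommRing R] [Algebra k R] (x : Points k (hopf σ (ProdMod f a b)) R)
      (j : Fin b) : Units.map (incl k K R : R →* K ⊗[k] R)
        (Units.map (pointAlgHom x : TorusRing σ (ProdMod f a b) →* R) (w j)) =
        (pointHom x (ProdMod.gen j)).unit := by
    rw [pointHom_apply, UnitsModule.unit_map, ← hw]
    ext
    exact (UnitsModule.tmap_tmul _ _ _).symm
  have hinj {R : Type u} [CommRing R] [Algebra k R] {r s : Rˣ}
      (h : Units.map (incl k K R : R →* K ⊗[k] R) r = Units.map (incl k K R : R →* K ⊗[k] R) s) :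
      r = s := by
    ext
    exact incl_injective k K R (congrArg Units.val h)
  let E (R : Type u) [CommRing R] [Algebra k R] : Points k (hopf σ (ProdMod f a b)) R →ₙ*
      (Fin a → Points k (hopf σ (CharMod f)) R) × (Fin b → Rˣ) :=
    { toFun x := (fun i => x.push (mapHom σ (ProdMod.inc i)),
        fun j => Units.map (pointAlgHom x : TorusRing σ (ProdMod f a b) →* R) (w j))
      map_mul' x y := by
        apply Prod.ext
        · ext i : 1
          apply pointHom_injective
          apply LinearMap.ext
          intro m
          simp [pointHom_mul, pointHom_push]
        · ext j : 1
          apply hinj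
          rw [Prod.snd_mul, Pi.mul_apply, map_mul, hx, hx, hx, pointHom_mul]
          rfl }
  have hE (R : Type u) [CommRing R] [Algebra k R] : Function.Bijective (E R) := by
    constructor
    · intro x y hxy
      apply pointHom_injective
      apply ProdMod.hom_ext
      · intro i m
        have := congrFun (congrArg Prod.fst hxy) i
        rw [← pointHom_push, ← pointHom_push]
        exact congrArg (fun z => pointHom z m) this
      · intro j
        apply UnitsModule.unit_injective
        rw [← hx, ← hx]
        exact congrArg _ (congrFun (congrArg Prod.snd hxy) j)
    · rintro ⟨y, r⟩
      obtain ⟨φ, h1, h2⟩ := ProdMod.exists_hom (fun i => pointHom (y i))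
        (fun j => UnitsModule.of σ (Units.map (incl k K R : R →* K ⊗[k] R) (r j)))
        (fun j => by
          apply UnitsModule.unit_injective
          ext
          simp)
      obtain ⟨x, rfl⟩ := pointHom_surjective φ
      refine ⟨x, Prod.ext ?_ ?_⟩
      · ext i : 1
        apply pointHom_injective
        apply LinearMap.ext
        intro m
        exact (pointHom_push _ _ _).trans (h1 i m)
      · ext j : 1
        apply hinj
        exact (hx x j).trans (congrArg UnitsModule.unit (h2 j))
  refine ⟨fun R _ _ => MulEquiv.ofBijective (E R) (hE R), ?_⟩
  intro R S _ _ _ _ g x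
  rfl

end Product

/-- Take for A the copy of ⟨x⟩^a × 1, whose order is (ℓ^m)^a. -/
lemma IsProduct.exists_finite_subgroup {k : Type u} [Field k] {H₀ H : CommHopfAlgCat.{u} k}
    {a b : ℕ} (h : IsProduct k H₀ a b H) {ℓ m : ℕ} [Fact ℓ.Prime] {x : Points k H₀ k}
    (hx : orderOf x = ℓ ^ m) : ∃ A : Subgroup (Points k H k), Finite A ∧
      padicValNat ℓ (Nat.card A) = m * a := by
  obtain ⟨e, -⟩ := h
  let ψ : (Fin a → Subgroup.zpowers x) →* Points k H k :=
    (e k).symm.toMonoidHom.comp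
      { toFun c := (fun i => c i, 1)
        map_one' := rfl
        map_mul' c d := Prod.ext rfl (one_mul 1).symm }
  have hψ : Function.Injective ψ := by
    intro c d hcd
    have := (e k).symm.injective hcd
    exact funext fun i => Subtype.ext (congrFun (congrArg Prod.fst this) i)
  have hcard : Nat.card ψ.range = ℓ ^ (m * a) := by
    rw [← Nat.card_congr (MonoidHom.ofInjective hψ).toEquiv, Nat.card_fun, Nat.card_zpowers, hx]
    simp [pow_mul]
  have hpos : 0 < ℓ ^ (m * a) := pow_pos (Fact.out : ℓ.Prime).pos _
  refine ⟨ψ.range, Nat.finite_of_card_ne_zero (by omega), ?_⟩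
  rw [hcard, padicValNat.prime_pow]

end SerreTorus

end

/-! ### The image of the cyclotomic character modulo powers of ℓ. -/

noncomputable section

namespace SerreTorus

section Padic

variable {ℓ : ℕ} [Fact ℓ.Prime]

variable (ℓ) in
/-- Reduction of units of `ℤ_ℓ` modulo `ℓ ^ n`. -/
def red (n : ℕ) : ℤ_[ℓ]ˣ →* (ZMod (ℓ ^ n))ˣ :=
  Units.map (PadicInt.toZModPow n : ℤ_[ℓ] →+* ZMod (ℓ ^ n))

lemma toZModPow_eq_zero_iff {n : ℕ} {x : ℤ_[ℓ]} :
    PadicInt.toZModPow n x = 0 ↔ (ℓ : ℤ_[ℓ]) ^ n ∣ x := by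
  rw [← RingHom.mem_ker, PadicInt.ker_toZModPow, Ideal.mem_span_singleton]

lemma red_eq_one_iff {n : ℕ} {u : ℤ_[ℓ]ˣ} : red ℓ n u = 1 ↔ (ℓ : ℤ_[ℓ]) ^ n ∣ (u : ℤ_[ℓ]) - 1 := by
  rw [← toZModPow_eq_zero_iff, map_sub, map_one, sub_eq_zero, Units.ext_iff]
  rfl

lemma red_eq_neg_one_iff {n : ℕ} {u : ℤ_[ℓ]ˣ} :
    red ℓ n u = -1 ↔ (ℓ : ℤ_[ℓ]) ^ n ∣ (u : ℤ_[ℓ]) + 1 := by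
  rw [← toZModPow_eq_zero_iff, map_add, map_one, Units.ext_iff, eq_neg_iff_add_eq_zero.symm]
  rfl

lemma mem_oneUnits_iff {m : ℕ} {u : ℤ_[ℓ]ˣ} : u ∈ oneUnits ℓ (m : ℕ∞) ↔ red ℓ m u = 1 := by
  rw [red_eq_one_iff]
  rfl

lemma red_eq_one_of_le {n m : ℕ} (h : n ≤ m) {u : ℤ_[ℓ]ˣ} (hu : red ℓ m u = 1) :
    red ℓ n u = 1 := by
  rw [red_eq_one_iff] at hu ⊢
  exact (pow_dvd_pow _ h).trans hu

/-- A residue class is the preimage of a closed ball around 0 after translation by a lift.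
Closedness serves case (b), where the image is only given as a topological closure. -/
lemma isClosed_red_eq {m : ℕ} (c : (ZMod (ℓ ^ m))ˣ) : IsClosed {u : ℤ_[ℓ]ˣ | red ℓ m u = c} := by
  obtain ⟨a, ha⟩ := ZMod.ringHom_surjective (PadicInt.toZModPow m : ℤ_[ℓ] →+* _) (c : ZMod (ℓ ^ m))
  have : {u : ℤ_[ℓ]ˣ | red ℓ m u = c} =
      (fun u : ℤ_[ℓ]ˣ => (u : ℤ_[ℓ]) - a) ⁻¹' (Metric.closedBall 0 ((ℓ : ℝ) ^ (-m : ℤ))) := by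
    ext u
    rw [Set.mem_ofPred_eq, Set.mem_preimage, mem_closedBall_zero_iff,
      PadicInt.norm_le_pow_iff_mem_span_pow, Ideal.mem_span_singleton, ← toZModPow_eq_zero_iff,
      map_sub, ha, sub_eq_zero, Units.ext_iff]
    rfl
  rw [this]
  exact Metric.isClosed_closedBall.preimage (Units.continuous_val.sub continuous_const)

variable (ℓ) in
/-- The subgroup of the units congruent to `1` or `-1` modulo `ℓ ^ m`. -/
def signUnits (m : ℕ) : Subgroup ℤ_[ℓ]ˣ where
  carrier := {u | red ℓ m u = 1 ∨ red ℓ m u = -1}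
  one_mem' := by simp
  mul_mem' := by
    rintro a b (ha | ha) (hb | hb) <;> simp [ha, hb]
  inv_mem' := by
    rintro a (ha | ha) <;> simp [ha]

lemma isClosed_signUnits (m : ℕ) : IsClosed (signUnits ℓ m : Set ℤ_[ℓ]ˣ) :=
  (isClosed_red_eq 1).union (isClosed_red_eq (-1))

/-- In (c - 1)(1 + c + ⋯ + c^(t-1)) = 0 the second factor reduces to t mod ℓ, which is nonzero
because t divides ℓ - 1. -/
lemma eq_one_of_pow_eq_one {t : ℕ} (ht : t ∣ ℓ - 1) {c : ℤ_[ℓ]ˣ} (hc : c ^ t = 1)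
    (h : red ℓ 1 c = 1) : c = 1 := by
  have hc' : ((c : ℤ_[ℓ]) - 1) * ∑ i ∈ Finset.range t, (c : ℤ_[ℓ]) ^ i = 0 := by
    rw [mul_geom_sum, ← Units.val_pow_eq_pow_val, hc]
    simp
  rcases mul_eq_zero.mp hc' with h0 | h0
  · exact Units.ext (sub_eq_zero.mp h0)
  · exfalso
    have h1 : PadicInt.toZModPow 1 (c : ℤ_[ℓ]) = 1 := congrArg Units.val h
    have h2 := congrArg (PadicInt.toZModPow 1) h0
    rw [map_sum, map_zero] at h2
    simp only [map_pow, h1, one_pow, Finset.sum_const, Finset.card_range, nsmul_eq_mul,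
      mul_one] at h2
    rw [ZMod.natCast_eq_zero_iff, pow_one] at h2
    have hl := (Fact.out : ℓ.Prime).two_le
    have h3 := Nat.le_of_dvd (by omega) (h2.trans ht)
    omega

end Padic

section Invariants

variable {k : Type u} [Field k] {ℓ : ℕ} [Fact ℓ.Prime] {t m : ℕ}

variable (ℓ) in
/-- The exponent of `ℓ` in the order of the roots of unity generating `cyclotomicField k ℓ`. -/
def baseExp : ℕ := if ℓ = 2 then 2 else 1

lemma pow_baseExp : ℓ ^ baseExp ℓ = if ℓ = 2 then 4 else ℓ := by
  rw [baseExp]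
  split_ifs with h
  · subst h; rfl
  · exact pow_one ℓ

lemma baseExp_le (htm : IsCyclotomicInvariants k ℓ t (m : ℕ∞)) : baseExp ℓ ≤ m := by
  rw [baseExp]
  rcases htm with ⟨h, hm, -⟩ | ⟨h, hm, -⟩
  · rw [if_neg h]; exact_mod_cast hm
  · rw [if_pos h]; exact_mod_cast hm

lemma cyclotomicImage_le_signUnits (htm : IsCyclotomicInvariants k ℓ t (m : ℕ∞)) (h2 : ℓ = 2) :
    cyclotomicImage k ℓ ≤ signUnits ℓ m := by
  rcases htm with ⟨h, -⟩ | ⟨-, -, ⟨-, h⟩ | ⟨-, g, hg, h⟩ | ⟨-, h⟩⟩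
  · exact absurd h2 h
  · rw [h]
    exact fun u hu => Or.inl (mem_oneUnits_iff.mp hu)
  · rw [h]
    refine Subgroup.topologicalClosure_minimal _ ?_ (isClosed_signUnits m)
    rw [Subgroup.zpowers_le]
    refine Or.inr (red_eq_neg_one_iff.mpr ?_)
    rw [hg, neg_add_cancel_comm]
    exact dvd_rfl
  · rw [h]
    refine sup_le ?_ fun u hu => Or.inl (mem_oneUnits_iff.mp hu)
    rw [Subgroup.zpowers_le]
    refine Or.inr (red_eq_neg_one_iff.mpr (by simp))

/-- This is the property of m that forces the ℓ^m-th roots of unity into K. For ℓ = 2, elements of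
the image are ±1 mod 2^m and congruence to 1 mod 4 excludes the sign -1; for odd ℓ, C_t injects into
the units mod ℓ. -/
lemma red_eq_one_of_mem (htm : IsCyclotomicInvariants k ℓ t (m : ℕ∞)) {u : ℤ_[ℓ]ˣ}
    (hu : u ∈ cyclotomicImage k ℓ) (h : red ℓ (baseExp ℓ) u = 1) : red ℓ m u = 1 := by
  have hm := baseExp_le htm
  by_cases h2 : ℓ = 2
  · rcases cyclotomicImage_le_signUnits htm h2 hu with h1 | h1
    · exact h1
    · exfalso
      have hb : baseExp ℓ = 2 := if_pos h2
      rw [hb] at h hm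
      rw [red_eq_one_iff] at h
      rw [red_eq_neg_one_iff] at h1
      -- Since m ≥ 2, the congruences u ≡ -1 and u ≡ 1 would both hold mod 4, giving 4 ∣ 2.
      have h3 := dvd_sub ((pow_dvd_pow _ hm).trans h1) h
      rw [← toZModPow_eq_zero_iff, add_sub_sub_cancel, map_add, map_one] at h3
      subst h2
      revert h3
      decide
  · rcases htm with ⟨-, -, htl, C, -, hC, hI⟩ | ⟨h, -⟩
    · have hb : baseExp ℓ = 1 := if_neg h2
      rw [hb] at h hm
      rw [hI] at hu
      obtain ⟨c, hc, v, hv, rfl⟩ := Subgroup.mem_sup.mp hu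
      rw [mem_oneUnits_iff] at hv
      have hc1 : c = 1 := by
        apply eq_one_of_pow_eq_one htl
        · rw [← hC]
          exact congrArg Subtype.val (pow_card_eq_one' (x := (⟨c, hc⟩ : C)))
        · rwa [map_mul, red_eq_one_of_le hm hv, mul_one] at h
      rwa [hc1, one_mul]
    · exact absurd h h2

/-- The factor 1 + ℓ^m ℤ_ℓ dies modulo ℓ (or 4). What survives is C_t for odd ℓ; for ℓ = 2 it is
trivial in case (a) and {±1} in cases (b) and (c). -/
lemma card_map_red (htm : IsCyclotomicInvariants k ℓ t (m : ℕ∞)) :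
    Nat.card ((cyclotomicImage k ℓ).map (red ℓ (baseExp ℓ))) = t := by
  have hm := baseExp_le htm
  have hone : (oneUnits ℓ (m : ℕ∞)).map (red ℓ (baseExp ℓ)) = ⊥ := by
    rw [Subgroup.map_eq_bot_iff]
    exact fun u hu => red_eq_one_of_le hm (mem_oneUnits_iff.mp hu)
  have htwo (h2 : ℓ = 2) (h : ∃ u ∈ cyclotomicImage k ℓ, red ℓ m u = -1) :
      Nat.card ((cyclotomicImage k ℓ).map (red ℓ (baseExp ℓ))) = 2 := by
    have hb : baseExp ℓ = 2 := if_pos h2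
    rw [hb] at hm ⊢
    obtain ⟨u, hu, h⟩ := h
    rw [red_eq_neg_one_iff] at h
    have h' : red ℓ 2 u = -1 := red_eq_neg_one_iff.mpr ((pow_dvd_pow _ hm).trans h)
    subst h2
    -- The unit group of ℤ/4 has order 2, so a subgroup containing -1 ≠ 1 is everything.
    have h1 : Nat.card ((cyclotomicImage k 2).map (red 2 2)) ∣ Nat.card (ZMod (2 ^ 2))ˣ :=
      Subgroup.card_subgroup_dvd_card _
    have h3 : Nat.card (ZMod (2 ^ 2))ˣ = 2 := by
      rw [Nat.card_eq_fintype_card]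
      decide
    rw [h3] at h1
    rcases (Nat.dvd_prime Nat.prime_two).mp h1 with h4 | h4
    · exfalso
      rw [Subgroup.card_eq_one] at h4
      have h5 : red 2 2 u ∈ (cyclotomicImage k 2).map (red 2 2) := ⟨u, hu, rfl⟩
      rw [h4, Subgroup.mem_bot, h'] at h5
      revert h5
      decide
    · exact h4
  rcases htm with ⟨h2, -, htl, C, -, hC, hI⟩ | ⟨h2, -, ⟨rfl, h⟩ | ⟨rfl, g, hg, h⟩ | ⟨rfl, h⟩⟩
  · have hb : baseExp ℓ = 1 := if_neg h2
    rw [hI, Subgroup.map_sup, hone, sup_bot_eq, hb, ← hC]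
    refine (Nat.card_congr (Equiv.ofBijective _
      ⟨?_, (red ℓ 1).subgroupMap_surjective C⟩)).symm
    rw [injective_iff_map_eq_one]
    intro c hc
    refine Subtype.ext (eq_one_of_pow_eq_one htl ?_ (congrArg Subtype.val hc))
    rw [← hC]
    exact congrArg Subtype.val (pow_card_eq_one' (x := c))
  · rw [h, hone]
    simp
  · refine htwo h2 ⟨g, ?_, ?_⟩
    · rw [h]
      exact Subgroup.le_topologicalClosure _ (Subgroup.mem_zpowers g)
    · rw [red_eq_neg_one_iff, hg, neg_add_cancel_comm]
      exact dvd_rfl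
  · refine htwo h2 ⟨-1, ?_, ?_⟩
    · rw [h]
      exact Subgroup.mem_sup_left (Subgroup.mem_zpowers _)
    · rw [red_eq_neg_one_iff]
      simp

end Invariants

end SerreTorus

end

/-! ### The field K, its Galois group and its roots of unity. -/

noncomputable section

namespace SerreTorus

section Galois

variable (k : Type u) [Field k] (ℓ : ℕ) [Fact ℓ.Prime]

/-- The `ℓ^∞`-cyclotomic character of the absolute Galois group. -/
def cycChar : Gal(SeparableClosure k/k) →* ℤ_[ℓ]ˣ :=
  (cyclotomicCharacter (SeparableClosure k) ℓ).comp
    (MulSemiringAction.toRingAut Gal(SeparableClosure k/k) (SeparableClosure k))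

lemma range_cycChar : (cycChar k ℓ).range = cyclotomicImage k ℓ := rfl

variable {k ℓ}

lemma cycChar_spec [NeZero (ℓ : k)] (g : Gal(SeparableClosure k/k)) {n : ℕ}
    {z : SeparableClosure k} (hz : z ^ ℓ ^ n = 1) :
    g z = z ^ (red ℓ n (cycChar k ℓ g) : ZMod (ℓ ^ n)).val :=
  cyclotomicCharacter.spec ℓ (MulSemiringAction.toRingAut Gal(SeparableClosure k/k) _ g) z hz

lemma red_cycChar_eq_iff [NeZero (ℓ : k)] (g : Gal(SeparableClosure k/k)) {n : ℕ}
    {z : SeparableClosure k} (hz : IsPrimitiveRoot z (ℓ ^ n)) (c : ZMod (ℓ ^ n)) :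
    (red ℓ n (cycChar k ℓ g) : ZMod (ℓ ^ n)) = c ↔ g z = z ^ c.val := by
  rw [cycChar_spec g hz.pow_eq_one]
  constructor
  · rintro rfl
    rfl
  · intro h
    exact ZMod.val_injective _ (hz.pow_inj (ZMod.val_lt _) (ZMod.val_lt _) h)

lemma red_cycChar_eq_one_iff [NeZero (ℓ : k)] (g : Gal(SeparableClosure k/k)) {n : ℕ}
    {z : SeparableClosure k} (hz : IsPrimitiveRoot z (ℓ ^ n)) :
    red ℓ n (cycChar k ℓ g) = 1 ↔ g z = z := by
  rw [Units.ext_iff, Units.val_one]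
  -- For n = 0 the ring ℤ/1 is trivial and the representative of 1 is 0, so this case is separated.
  by_cases hn : ℓ ^ n = 1
  · have hz1 : z = 1 := by simpa [hn] using hz.pow_eq_one
    have : Subsingleton (ZMod (ℓ ^ n)) := by rw [hn]; infer_instance
    simp [hz1, eq_iff_true_of_subsingleton]
  · have : Fact (1 < ℓ ^ n) := ⟨by
      have := pow_pos (Fact.out : ℓ.Prime).pos n
      omega⟩
    rw [red_cycChar_eq_iff g hz, ZMod.val_one, pow_one]

variable [NeZero (ℓ : k)]

variable (k ℓ) in
omit [Fact ℓ.Prime] in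
lemma exists_isPrimitiveRoot (n : ℕ) : ∃ z : SeparableClosure k, IsPrimitiveRoot z (ℓ ^ n) :=
  HasEnoughRootsOfUnity.exists_primitiveRoot _ _

omit [NeZero (ℓ : k)] in
lemma cyclotomicField_eq {z : SeparableClosure k} (hz : IsPrimitiveRoot z (ℓ ^ baseExp ℓ)) :
    cyclotomicField k ℓ = IntermediateField.adjoin k {z} := by
  rw [cyclotomicField, ← pow_baseExp]
  apply le_antisymm
  · rw [IntermediateField.adjoin_le_iff]
    intro w hw
    obtain ⟨i, -, rfl⟩ := hz.eq_pow_of_pow_eq_one (IsPrimitiveRoot.pow_eq_one hw)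
    exact pow_mem (IntermediateField.mem_adjoin_simple_self k z) i
  · exact IntermediateField.adjoin.mono k _ _ (Set.singleton_subset_iff.mpr hz)

omit [NeZero (ℓ : k)] in
lemma isPrimitiveRoot_mem {z : SeparableClosure k} (hz : IsPrimitiveRoot z (ℓ ^ baseExp ℓ)) :
    z ∈ cyclotomicField k ℓ := by
  rw [cyclotomicField_eq hz]
  exact IntermediateField.mem_adjoin_simple_self k z

instance isCyclotomicExtension_cyclotomicField :
    IsCyclotomicExtension {ℓ ^ baseExp ℓ} k (cyclotomicField k ℓ) := by
  obtain ⟨z, hz⟩ := exists_isPrimitiveRoot k ℓ (baseExp ℓ)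
  rw [cyclotomicField_eq hz]
  exact hz.intermediateField_adjoin_isCyclotomicExtension k

instance finiteDimensional_cyclotomicField : FiniteDimensional k (cyclotomicField k ℓ) :=
  IsCyclotomicExtension.finiteDimensional {ℓ ^ baseExp ℓ} k _

instance isGalois_cyclotomicField : IsGalois k (cyclotomicField k ℓ) :=
  IsCyclotomicExtension.isGalois {ℓ ^ baseExp ℓ} k _

variable (k ℓ) in
lemma exists_isPrimitiveRoot_cyclotomicField :
    ∃ z : cyclotomicField k ℓ, IsPrimitiveRoot z (ℓ ^ baseExp ℓ) := by
  obtain ⟨z, hz⟩ := exists_isPrimitiveRoot k ℓ (baseExp ℓ)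
  exact ⟨⟨z, isPrimitiveRoot_mem hz⟩, IsPrimitiveRoot.coe_submonoidClass_iff.mp hz⟩

variable (k ℓ) in
lemma isCyclic_gal : IsCyclic Gal(cyclotomicField k ℓ/k) := by
  obtain ⟨z, hz⟩ := exists_isPrimitiveRoot_cyclotomicField k ℓ
  have : IsCyclic (ZMod (ℓ ^ baseExp ℓ))ˣ := by
    by_cases h : ℓ = 2
    · rw [pow_baseExp, if_pos h]
      exact ZMod.isCyclic_units_four
    · exact ZMod.isCyclic_units_of_prime_pow ℓ Fact.out h _
  exact isCyclic_of_injective (hz.autToPow k) (hz.autToPow_injective k)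

lemma autToPow_restrict {z : cyclotomicField k ℓ} (hz : IsPrimitiveRoot z (ℓ ^ baseExp ℓ))
    (g : Gal(SeparableClosure k/k)) :
    hz.autToPow k (AlgEquiv.restrictNormalHom (cyclotomicField k ℓ) g) =
      red ℓ (baseExp ℓ) (cycChar k ℓ g) := by
  have hz' : IsPrimitiveRoot (z : SeparableClosure k) (ℓ ^ baseExp ℓ) :=
    IsPrimitiveRoot.coe_submonoidClass_iff.mpr hz
  symm
  ext1
  rw [red_cycChar_eq_iff g hz', ← AlgEquiv.restrictNormalHom_apply, ← hz.autToPow_spec k]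
  rfl

/-- Gal(K/k) acts faithfully on the roots of unity generating K, and through this action it is
identified with the cyclotomic image modulo ℓ (or 4). -/
lemma card_gal {t m : ℕ} (htm : IsCyclotomicInvariants k ℓ t (m : ℕ∞)) :
    Nat.card Gal(cyclotomicField k ℓ/k) = t := by
  obtain ⟨z, hz⟩ := exists_isPrimitiveRoot_cyclotomicField k ℓ
  rw [← card_map_red htm, ← range_cycChar,
    Nat.card_congr (MonoidHom.ofInjective (hz.autToPow_injective k)).toEquiv]
  have h : (hz.autToPow k).range = (cycChar k ℓ).range.map (red ℓ (baseExp ℓ)) := by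
    ext u
    constructor
    · rintro ⟨σ, rfl⟩
      obtain ⟨g, rfl⟩ := AlgEquiv.restrictNormalHom_surjective (SeparableClosure k) σ
      exact ⟨cycChar k ℓ g, ⟨g, rfl⟩, (autToPow_restrict hz g).symm⟩
    · rintro ⟨-, ⟨g, rfl⟩, rfl⟩
      exact ⟨_, autToPow_restrict hz g⟩
  rw [h]

/-- By Galois theory it suffices that every g fixing K fixes z. Such a g has character 1 modulo ℓ
(or 4), hence modulo ℓ^m by `red_eq_one_of_mem`. -/
lemma mem_cyclotomicField {t m : ℕ} (htm : IsCyclotomicInvariants k ℓ t (m : ℕ∞))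
    {z : SeparableClosure k} (hz : IsPrimitiveRoot z (ℓ ^ m)) : z ∈ cyclotomicField k ℓ := by
  obtain ⟨w, hw⟩ := exists_isPrimitiveRoot k ℓ (baseExp ℓ)
  rw [← InfiniteGalois.fixedField_fixingSubgroup (cyclotomicField k ℓ),
    IntermediateField.mem_fixedField_iff]
  intro g hg
  rw [IntermediateField.mem_fixingSubgroup_iff] at hg
  rw [← red_cycChar_eq_one_iff g hz]
  exact red_eq_one_of_mem htm ⟨g, rfl⟩
    ((red_cycChar_eq_one_iff g hw).mpr (hg w (isPrimitiveRoot_mem hw)))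

lemma gal_eq_one {z : cyclotomicField k ℓ} (hz : IsPrimitiveRoot z (ℓ ^ baseExp ℓ))
    {σ : Gal(cyclotomicField k ℓ/k)} (h : σ z = z) : σ = 1 := by
  have : (σ : cyclotomicField k ℓ →ₐ[k] cyclotomicField k ℓ) = AlgHom.id k _ :=
    (hz.powerBasis k).algHom_ext (by simpa using h)
  exact AlgEquiv.ext fun x => DFunLike.congr_fun this x

end Galois

/-! ### The exponent s with σ z = z^s, and the value Φ_t(s). -/

open Polynomial

lemma psi_mul_cyclotomic (t : ℕ) : psi t * cyclotomic t ℤ = X ^ t - 1 := by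
  have h : cyclotomic t ℤ ∣ X ^ t - 1 := cyclotomic.dvd_X_pow_sub_one t ℤ
  obtain ⟨q, hq⟩ := h
  rw [psi, hq, mul_divByMonic_cancel_left _ (cyclotomic.monic t ℤ), mul_comm]

lemma psi_ne_zero {t : ℕ} (ht : 0 < t) : psi t ≠ 0 := by
  intro h
  have := psi_mul_cyclotomic t
  rw [h, zero_mul] at this
  exact X_pow_sub_C_ne_zero ht (1 : ℤ) (by rw [C_1]; exact this.symm)

/-- Since Ψ(s) Φ_t(s) = s^t - 1, it is enough that ℓ does not divide Ψ(s). Modulo ℓ, s is already a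
root of Φ_t, and X^t - 1 has no double root other than possibly 0 because ℓ ∤ t. -/
lemma pow_dvd_eval_cyclotomic {ℓ : ℕ} [Fact ℓ.Prime] {t m : ℕ} (ht : t ∣ ℓ - 1) {s : ℤ}
    (hs : (ℓ : ℤ) ^ m ∣ s ^ t - 1) (hs' : IsPrimitiveRoot (s : ZMod ℓ) t) :
    (ℓ : ℤ) ^ m ∣ (cyclotomic t ℤ).eval s := by
  have hl := (Fact.out : ℓ.Prime).two_le
  have ht0 : 0 < t := Nat.pos_of_dvd_of_pos ht (by omega)
  have hmul := psi_mul_cyclotomic t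
  have h1 : (psi t).eval s * (cyclotomic t ℤ).eval s = s ^ t - 1 := by
    rw [← eval_mul, hmul]
    simp
  rw [← h1] at hs
  refine IsCoprime.dvd_of_dvd_mul_left (IsCoprime.pow_left ?_) hs
  rw [Prime.coprime_iff_not_dvd (Nat.prime_iff_prime_int.mp Fact.out),
    ← ZMod.intCast_zmod_eq_zero_iff_dvd]
  intro h0
  have hmul' : (psi t).map (Int.castRingHom (ZMod ℓ)) * cyclotomic t (ZMod ℓ) = X ^ t - 1 := by
    rw [← map_cyclotomic_int, ← Polynomial.map_mul, hmul]
    simp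
  have h2 : ((psi t).map (Int.castRingHom (ZMod ℓ))).eval (s : ZMod ℓ) = 0 := by
    rw [← h0]
    exact eval_intCast_map (Int.castRingHom (ZMod ℓ)) (psi t) s
  have h3 : (cyclotomic t (ZMod ℓ)).eval (s : ZMod ℓ) = 0 := hs'.isRoot_cyclotomic ht0
  -- A common root of Ψ and Φ_t would kill the derivative of the product, giving t s^(t-1) = 0 in
  -- 𝔽_ℓ.
  have h4 := congrArg (fun p => (derivative p).eval (s : ZMod ℓ)) hmul'
  simp only [derivative_mul, eval_add, eval_mul, h2, h3, mul_zero, zero_mul, add_zero,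
    derivative_sub, derivative_X_pow, derivative_one, sub_zero, eval_pow, eval_X, eval_C] at h4
  rcases mul_eq_zero.mp h4.symm with h5 | h5
  · rw [ZMod.natCast_eq_zero_iff] at h5
    have := Nat.le_of_dvd (by omega) (h5.trans ht)
    omega
  · exact hs'.ne_zero ht0.ne' (eq_zero_of_pow_eq_zero h5)

section Eigenvector

variable {k : Type u} [Field k] {ℓ : ℕ} [Fact ℓ.Prime] [NeZero (ℓ : k)] {t m : ℕ}

omit [NeZero (ℓ : k)] in
lemma isPrimitiveRoot_pow_sub {z : cyclotomicField k ℓ} {b : ℕ} (hb : b ≤ m)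
    (hz : IsPrimitiveRoot z (ℓ ^ m)) : IsPrimitiveRoot (z ^ ℓ ^ (m - b)) (ℓ ^ b) :=
  hz.pow (pow_pos (Fact.out : ℓ.Prime).pos _) (by rw [← pow_add, Nat.sub_add_cancel hb])

lemma exists_root_eigenvector_of_ne_two (htm : IsCyclotomicInvariants k ℓ t (m : ℕ∞))
    (h2 : ℓ ≠ 2) {σ : Gal(cyclotomicField k ℓ/k)} (hσ : orderOf σ = t)
    {z : (cyclotomicField k ℓ)ˣ} (hz : IsPrimitiveRoot z (ℓ ^ m)) :
    ∃ s : ℤ, Units.map (σ : cyclotomicField k ℓ →* cyclotomicField k ℓ) z = z ^ s ∧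
      (ℓ : ℤ) ^ m ∣ (cyclotomic t ℤ).eval s := by
  have hm := baseExp_le htm
  have hb : baseExp ℓ = 1 := if_neg h2
  rw [hb] at hm
  have htl : t ∣ ℓ - 1 := by
    rcases htm with ⟨-, -, h, -⟩ | ⟨h, -⟩
    · exact h
    · exact absurd h h2
  have hz' := IsPrimitiveRoot.coe_units_iff.mpr hz
  obtain ⟨s, -, hs⟩ := hz'.eq_pow_of_pow_eq_one (ξ := σ z) (by
    rw [← map_pow, hz'.pow_eq_one, map_one])
  have hpow (d : ℕ) : ((σ ^ d) (z : cyclotomicField k ℓ)) = (z : cyclotomicField k ℓ) ^ s ^ d := by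
    induction d with
    | zero => simp
    | succ d ih =>
      rw [pow_succ', AlgEquiv.mul_apply, ih, map_pow, pow_succ', pow_mul]
      rw [hs]
  have hS : (ℓ : ℤ) ^ m ∣ (s : ℤ) ^ t - 1 := by
    have h := hpow t
    rw [← hσ, pow_orderOf_eq_one, hσ] at h
    have h' : z ^ ((s : ℤ) ^ t - 1) = 1 := by
      rw [zpow_sub_one, mul_inv_eq_one]
      ext1
      refine Eq.trans ?_ h.symm
      norm_cast
    exact_mod_cast (hz.zpow_eq_one_iff_dvd _).mp h'
  refine ⟨s, Units.ext (by simp [hs]), pow_dvd_eval_cyclotomic htl hS ?_⟩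
  -- The ℓ-th root of unity z^(ℓ^(m-1)) generates K, so a power of σ fixing it is trivial; hence the
  -- order of s mod ℓ is exactly the order t of σ.
  · have hroot := isPrimitiveRoot_pow_sub hm hz'
    rw [← hb] at hroot
    have hdvd : (ℓ : ℤ) ∣ (s : ℤ) ^ t - 1 := (dvd_pow_self _ (by omega)).trans hS
    constructor
    · rw [← ZMod.intCast_zmod_eq_zero_iff_dvd] at hdvd
      push_cast at hdvd ⊢
      exact sub_eq_zero.mp hdvd
    · intro l hl
      rw [← hσ]
      apply orderOf_dvd_of_pow_eq_one
      apply gal_eq_one hroot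
      rw [map_pow, hpow, ← pow_mul, mul_comm, pow_mul]
      have h' : s ^ l ≡ 1 [MOD ℓ ^ baseExp ℓ] := by
        rw [hb, pow_one, ← ZMod.natCast_eq_natCast_iff]
        push_cast at hl ⊢
        exact hl
      simpa using pow_eq_pow_of_modEq h' hroot.pow_eq_one

lemma exists_root_eigenvector_of_eq_two (htm : IsCyclotomicInvariants k ℓ t (m : ℕ∞))
    (h2 : ℓ = 2) {σ : Gal(cyclotomicField k ℓ/k)} (hσ : orderOf σ = t)
    {z : (cyclotomicField k ℓ)ˣ} (hz : IsPrimitiveRoot z (ℓ ^ m)) :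
    ∃ s : ℤ, Units.map (σ : cyclotomicField k ℓ →* cyclotomicField k ℓ) z = z ^ s ∧
      (ℓ : ℤ) ^ m ∣ (cyclotomic t ℤ).eval s := by
  have ht : t = 1 ∨ t = 2 := by
    rcases htm with ⟨h, -⟩ | ⟨-, -, ⟨h, -⟩ | ⟨h, -⟩ | ⟨h, -⟩⟩
    · exact absurd h2 h
    · exact Or.inl h
    · exact Or.inr h
    · exact Or.inr h
  have hz' := IsPrimitiveRoot.coe_units_iff.mpr hz
  rcases ht with rfl | rfl
  · rw [orderOf_eq_one_iff] at hσ
    refine ⟨1, ?_, by simp⟩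
    rw [hσ, zpow_one]
    rfl
  · refine ⟨-1, ?_, by simp⟩
    obtain ⟨g, rfl⟩ := AlgEquiv.restrictNormalHom_surjective (SeparableClosure k) σ
    have hw : IsPrimitiveRoot ((z : cyclotomicField k ℓ) : SeparableClosure k) (ℓ ^ m) :=
      IsPrimitiveRoot.coe_submonoidClass_iff.mpr hz'
    have hr : (AlgEquiv.restrictNormalHom (cyclotomicField k ℓ) g z : SeparableClosure k) =
      g (z : cyclotomicField k ℓ) := AlgEquiv.restrictNormalHom_apply _ _ _
    -- The character of g is ±1 mod 2^m. The value 1 would make σ trivial, against its order 2; so σ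
    -- inverts z, and -1 is the root of Φ_2.
    rcases cyclotomicImage_le_signUnits htm h2 ⟨g, rfl⟩ with h | h
    · exfalso
      have h1 := (red_cycChar_eq_one_iff g hw).mp h
      rw [← hr] at h1
      have h3 := gal_eq_one (isPrimitiveRoot_pow_sub (baseExp_le htm) hz')
        (σ := AlgEquiv.restrictNormalHom (cyclotomicField k ℓ) g)
        (by rw [map_pow, Subtype.ext h1])
      rw [h3, orderOf_one] at hσ
      omega
    · rw [zpow_neg_one, eq_inv_iff_mul_eq_one]
      ext1
      apply Subtype.ext
      have h1 := (red_cycChar_eq_iff g hw _).mp (congrArg Units.val h)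
      change (AlgEquiv.restrictNormalHom (cyclotomicField k ℓ) g z : SeparableClosure k) *
        (z : cyclotomicField k ℓ) = 1
      rw [hr, h1, ← pow_succ, hw.pow_eq_one_iff_dvd, ← ZMod.natCast_eq_zero_iff]
      simp

lemma exists_root_eigenvector (htm : IsCyclotomicInvariants k ℓ t (m : ℕ∞))
    {σ : Gal(cyclotomicField k ℓ/k)} (hσ : orderOf σ = t) :
    ∃ (z : (cyclotomicField k ℓ)ˣ) (s : ℤ), orderOf z = ℓ ^ m ∧
      Units.map (σ : cyclotomicField k ℓ →* cyclotomicField k ℓ) z = z ^ s ∧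
      (ℓ : ℤ) ^ m ∣ (cyclotomic t ℤ).eval s := by
  obtain ⟨w, hw⟩ := exists_isPrimitiveRoot k ℓ m
  have hz' : IsPrimitiveRoot (⟨w, mem_cyclotomicField htm hw⟩ : cyclotomicField k ℓ) (ℓ ^ m) :=
    IsPrimitiveRoot.coe_submonoidClass_iff.mp hw
  have hz := hz'.isUnit_unit (pow_pos (Fact.out : ℓ.Prime).pos m).ne'
  obtain ⟨s, h1, h2⟩ : ∃ s : ℤ, _ := if h2 : ℓ = 2
    then exists_root_eigenvector_of_eq_two htm h2 hσ hz
    else exists_root_eigenvector_of_ne_two htm h2 hσ hz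
  exact ⟨_, s, hz.eq_orderOf.symm, h1, h2⟩

end Eigenvector

end SerreTorus

end

/-! ### Points of order ℓ^m and dimensions. -/

noncomputable section

namespace SerreTorus

open Polynomial TorusRing

/-- X - s kills v and divides p - p(s). -/
lemma smul_eq_eval_smul {N : Type*} [AddCommGroup N] [Module ℤ[X] N] {v : N} {s : ℤ}
    (hv : (X : ℤ[X]) • v = s • v) (p : ℤ[X]) : p • v = p.eval s • v := by
  have h0 : (X - C s : ℤ[X]) • v = 0 := by
    rw [sub_smul, hv, eq_intCast, Int.cast_smul_eq_zsmul, sub_self]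
  obtain ⟨q, hq⟩ := X_sub_C_dvd_sub_C_eval (a := s) (p := p)
  have h1 : (p - C (p.eval s)) • v = 0 := by
    rw [hq, mul_comm, mul_smul, h0, smul_zero]
  rw [sub_smul, sub_eq_zero, eq_intCast, Int.cast_smul_eq_zsmul] at h1
  exact h1

section Points

variable {k : Type u} [Field k] {K : Type u} [Field K] [Algebra k K] [FiniteDimensional k K]
  (σ : K ≃ₐ[k] K) (f : ℤ[X]) (R : Type u) [CommRing R] [Algebra k R]

/-- The embedding of the `R`-points of the group with character module `ℤ[X] / (f)` in
`(K ⊗ R)ˣ`. -/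
def evalOne : Points k (hopf σ (CharMod f)) R →* (K ⊗[k] R)ˣ :=
  MonoidHom.mk' (fun x => (pointHom x 1).unit) fun x y => by simp [pointHom_mul]

lemma evalOne_injective : Function.Injective (evalOne σ f R) := fun _ _ hxy =>
  pointHom_injective (CharMod.hom_ext (UnitsModule.unit_injective hxy))

variable {σ f R}

lemma exists_evalOne_eq {v : UnitsModule σ R} (hv : f • v = 0) :
    ∃ x, evalOne σ f R x = v.unit := by
  obtain ⟨φ, rfl⟩ := CharMod.exists_hom v hv
  obtain ⟨x, rfl⟩ := pointHom_surjective φ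
  exact ⟨x, rfl⟩

/-- The k-points are the units killed by f(σ), and f(σ) raises the eigenvector z to the power f(s),
a multiple of its order. -/
lemma exists_point_orderOf_eq {z : Kˣ} {s : ℤ} (hz : Units.map (σ : K →* K) z = z ^ s)
    (hs : (orderOf z : ℤ) ∣ f.eval s) :
    ∃ x : Points k (hopf σ (CharMod f)) k, orderOf x = orderOf z := by
  let i : K →ₐ[k] K ⊗[k] k := Algebra.TensorProduct.includeLeft
  have hi : Function.Injective (Units.map (i : K →* K ⊗[k] k)) :=
    Units.map_injective (RingHom.injective (i : K →+* K ⊗[k] k))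
  let v : UnitsModule σ k := UnitsModule.of σ (Units.map (i : K →* K ⊗[k] k) z)
  have hX : (X : ℤ[X]) • v = s • v := by
    apply UnitsModule.unit_injective
    rw [UnitsModule.unit_X_smul]
    refine Eq.trans ?_ (map_zpow (Units.map (i : K →* K ⊗[k] k)) z s)
    rw [← hz]
    ext
    simp [v, i]
  have hf : f • v = 0 := by
    rw [smul_eq_eval_smul hX]
    apply UnitsModule.unit_injective
    refine (map_zpow (Units.map (i : K →* K ⊗[k] k)) z (f.eval s)).symm.trans ?_
    rw [orderOf_dvd_iff_zpow_eq_one.mp hs, map_one]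
    rfl
  obtain ⟨x, hx⟩ := exists_evalOne_eq hf
  refine ⟨x, ?_⟩
  rw [← orderOf_injective _ (evalOne_injective σ f k), hx]
  exact orderOf_injective _ hi z

end Points

lemma isTorus_of_charMod {k : Type u} [Field k] {K : Type u} [Field K] [Algebra k K]
    [FiniteDimensional k K] {σ : K ≃ₐ[k] K} (hσ : orderOf σ = Module.finrank k K)
    (ι : K →ₐ[k] SeparableClosure k) {f : ℤ[X]} (hf : f.Monic) (hdvd : f ∣ X ^ orderOf σ - 1) :
    IsTorus k f.natDegree (hopf σ (CharMod f)) :=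
  isTorus_hopf σ hσ (CharMod.X_pow_smul (by rwa [← hσ])) ι (CharMod.equivFun hf)

lemma isTorus_of_prodMod {k : Type u} [Field k] {K : Type u} [Field K] [Algebra k K]
    [FiniteDimensional k K] {σ : K ≃ₐ[k] K} (hσ : orderOf σ = Module.finrank k K)
    (ι : K →ₐ[k] SeparableClosure k) {f : ℤ[X]} (hf : f.Monic) (hdvd : f ∣ X ^ orderOf σ - 1)
    (a b : ℕ) : IsTorus k (a * f.natDegree + b) (hopf σ (ProdMod f a b)) := by
  have h1 : (X - 1 : ℤ[X]).Monic := monic_X_sub_C 1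
  obtain ⟨e⟩ := CharMod.nonempty_prod_equiv hf h1 a b
  have hdeg : (X - 1 : ℤ[X]).natDegree = 1 := natDegree_X_sub_C 1
  rw [hdeg, mul_one] at e
  refine isTorus_hopf σ hσ (fun m => Prod.ext ?_ ?_) ι e
  · ext i : 1
    exact CharMod.X_pow_smul (by rwa [← hσ]) _
  · ext i : 1
    exact CharMod.X_pow_smul (sub_one_dvd_pow_sub_one _ _) _

end SerreTorus

end

/-! ### The theorem. -/

theorem theorem4 (k : Type u) [Field k] (ℓ : ℕ) [Fact ℓ.Prime] (hℓ : (ℓ : k) ≠ 0)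
    (t m : ℕ) (htm : SerreTorus.IsCyclotomicInvariants k ℓ t (m : ℕ∞)) :
    (∀ n : ℕ, 1 ≤ n →
      ∃ T : CommHopfAlgCat.{u} k, SerreTorus.IsTorus k n T ∧
        ∃ A : Subgroup (SerreTorus.Points k T k), Finite A ∧
          padicValNat ℓ (Nat.card A) = m * (n / Nat.totient t)) ∧
    IsCyclic Gal(SerreTorus.cyclotomicField k ℓ/k) ∧
    ∀ σ : Gal(SerreTorus.cyclotomicField k ℓ/k), Subgroup.zpowers σ = ⊤ →
      ∃ T₀ : CommHopfAlgCat.{u} k,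
        SerreTorus.IsImagePolyAct k σ (SerreTorus.psi t) T₀ ∧
        SerreTorus.IsTorus k (Nat.totient t) T₀ ∧
        (∃ x : SerreTorus.Points k T₀ k, orderOf x = ℓ ^ m) ∧
        ∀ n : ℕ, 1 ≤ n →
          ∃ T : CommHopfAlgCat.{u} k, SerreTorus.IsTorus k n T ∧
            SerreTorus.IsProduct k T₀ (n / Nat.totient t) (n % Nat.totient t) T ∧
            ∃ A : Subgroup (SerreTorus.Points k T k), Finite A ∧
              padicValNat ℓ (Nat.card A) = m * (n / Nat.totient t) := by
  have : NeZero (ℓ : k) := ⟨hℓ⟩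
  have hcyc := SerreTorus.isCyclic_gal k ℓ
  have main (σ : Gal(SerreTorus.cyclotomicField k ℓ/k)) (hgen : Subgroup.zpowers σ = ⊤) :
      ∃ T₀ : CommHopfAlgCat.{u} k,
        SerreTorus.IsImagePolyAct k σ (SerreTorus.psi t) T₀ ∧
        SerreTorus.IsTorus k (Nat.totient t) T₀ ∧
        (∃ x : SerreTorus.Points k T₀ k, orderOf x = ℓ ^ m) ∧
        ∀ n : ℕ, 1 ≤ n →
          ∃ T : CommHopfAlgCat.{u} k, SerreTorus.IsTorus k n T ∧
            SerreTorus.IsProduct k T₀ (n / Nat.totient t) (n % Nat.totient t) T ∧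
            ∃ A : Subgroup (SerreTorus.Points k T k), Finite A ∧
              padicValNat ℓ (Nat.card A) = m * (n / Nat.totient t) := by
    have hcard : orderOf σ = Nat.card Gal(SerreTorus.cyclotomicField k ℓ/k) :=
      orderOf_eq_card_of_zpowers_eq_top hgen
    have hσt : orderOf σ = t := hcard.trans (SerreTorus.card_gal htm)
    have hσ : orderOf σ = Module.finrank k (SerreTorus.cyclotomicField k ℓ) :=
      hcard.trans (IsGalois.card_aut_eq_finrank k _)
    have ht : 0 < t := by
      rw [← hσt]
      exact orderOf_pos σ
    -- Fixed by a generator means fixed by Gal(K/k), hence in k; this is what identifies the trivial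
    -- summands with 𝔾_m.
    have hfix (x : SerreTorus.cyclotomicField k ℓ) (hx : σ x = x) :
        x ∈ Set.range (algebraMap k (SerreTorus.cyclotomicField k ℓ)) := by
      rw [IsGalois.mem_range_algebraMap_iff_fixed]
      intro g
      have hg : g ∈ Subgroup.zpowers σ := hgen ▸ Subgroup.mem_top g
      have hle : Subgroup.zpowers σ ≤ MulAction.stabilizer _ x := by
        rw [Subgroup.zpowers_le]
        exact hx
      exact hle hg
    have hmul : SerreTorus.psi t * Polynomial.cyclotomic t ℤ = Polynomial.X ^ orderOf σ - 1 := by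
      rw [hσt, SerreTorus.psi_mul_cyclotomic]
    have hmonic := Polynomial.cyclotomic.monic t ℤ
    have hdvd : Polynomial.cyclotomic t ℤ ∣ Polynomial.X ^ orderOf σ - 1 :=
      ⟨_, by rw [← hmul, mul_comm]⟩
    obtain ⟨z, s, hz, hzs, hs⟩ := SerreTorus.exists_root_eigenvector htm hσt
    obtain ⟨x, hx⟩ := SerreTorus.exists_point_orderOf_eq (f := Polynomial.cyclotomic t ℤ) hzs
      (by rw [hz]; exact_mod_cast hs)
    rw [hz] at hx
    refine ⟨SerreTorus.TorusRing.hopf σ (SerreTorus.CharMod (Polynomial.cyclotomic t ℤ)),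
      SerreTorus.isImagePolyAct_hopf σ hσ (SerreTorus.cyclotomicField k ℓ).val hmul
        (SerreTorus.psi_ne_zero ht), ?_, ⟨x, hx⟩, fun n _ => ?_⟩
    · rw [← Polynomial.natDegree_cyclotomic t ℤ]
      exact SerreTorus.isTorus_of_charMod hσ (SerreTorus.cyclotomicField k ℓ).val hmonic hdvd
    · have hprod := SerreTorus.isProduct_hopf (f := Polynomial.cyclotomic t ℤ)
        (a := n / Nat.totient t) (b := n % Nat.totient t) hfix
      refine ⟨_, ?_, hprod, hprod.exists_finite_subgroup hx⟩
      have h := SerreTorus.isTorus_of_prodMod hσ (SerreTorus.cyclotomicField k ℓ).val hmonic hdvd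
        (n / Nat.totient t) (n % Nat.totient t)
      -- The remainder of n modulo φ(t) is b = n - a φ(t), so the dimension a φ(t) + b equals n.
      rwa [Polynomial.natDegree_cyclotomic, mul_comm, Nat.div_add_mod] at h
  refine ⟨fun n hn => ?_, hcyc, main⟩
  obtain ⟨σ, hgen⟩ := hcyc.exists_generator
  obtain ⟨_, _, _, _, h⟩ := main σ (Subgroup.eq_top_iff' _ |>.mpr hgen)
  obtain ⟨T, hT, -, hA⟩ := h n hn
  exact ⟨T, hT, hA⟩
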